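/- Let $\mathbb{K}$ be a field of characteristic zero. Let $\mathbf{FQSym}$ be the $\mathbb{K}$-vector space with basis $(\mathbf{F}_\sigma)$ indexed by all permutations $\sigma$ of all sizes $n\ge 0$, with the bilinear product $\mathbf{F}_\sigma\cdot\mathbf{F}_\nu=\sum_\pi \mathbf{F}_\pi$, where $\pi$ runs over the words in the shuffle of the word $\sigma$ with the word obtained from $\nu$ by adding $|\sigma|$ to each letter. A pair of twin binary trees of size $n$ is a pair $J=(T_L,T_R)$ of binary trees with $n$ internal nodes each and with complementary canopies; the canopy of a tree is the word read on its leaves from left to right, the first and the last leaf excepted, with $0$ for a leaf that is a right child and $1$ for a leaf that is a left child. For a word $u$ of integers, $\mathbb{P}(u)$ is the pair of labeled trees obtained from the pair of empty trees by inserting the letters of $u$ from left to right, each letter $a$ being inserted in both trees. In the left tree the insertion is at a leaf: at a node labeled $b$ go to the left subtree if $a<b$ and to the right subtree otherwise, until an empty place is reached. In the right tree the insertion is at the root: the new tree has root $a$, left subtree $T_{\le a}$ and right subtree $T_{>a}$, the restrictions of the former tree $T$ (a right binary search tree) to its labels $\le a$ and $>a$, which keep the ancestor relation of $T$. Write $\mathbb{P}(\sigma)=J$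 if the pair of unlabeled shapes of $\mathbb{P}(\sigma)$ is $J$, and put $\mathbf{P}_J=\sum_{\mathbb{P}(\sigma)=J}\mathbf{F}_\sigma$. Let $\mathbf{Baxter}$ be the subspace of $\mathbf{FQSym}$ spanned by all the $\mathbf{P}_J$. For pairs of twin binary trees $J_0,J_1$ of the same size $n$, write $J_0\le_B J_1$ if there are permutations $\sigma_0,\sigma_1$ of size $n$ with $\mathbb{P}(\sigma_0)=J_0$, $\mathbb{P}(\sigma_1)=J_1$ and $\sigma_0\le_P\sigma_1$, where $\le_P$ is the permutohedron order, that is, the reflexive and transitive closure of the relation $u\,a\,b\,v\to u\,b\,a\,v$ for letters $a<b$. Put $$\mathbf{E}_J=\sum_{J\le_B J'}\mathbf{P}_{J'},\qquad \mathbf{H}_J=\sum_{J'\le_B J}\mathbf{P}_{J'}.$$ For binary trees $S,T$ let $S\diagup T$ be obtained by grafting $S$ by its root on the leftmost leaf of $T$, and $S\diagdown T$ by grafting $T$ by its root on the rightmost leaf of $S$. For $J_0=(T_L^0,T_R^0)$ and $J_1=(T_L^1,T_R^1)$ let $$J_0\diagup J_1=(T_L^0\diagdown T_L^1,\;T_R^0\diagup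 T_R^1),\qquad J_0\diagdown J_1=(T_L^0\diagup T_L^1,\;T_R^0\diagdown T_R^1),$$ which are again pairs of twin binary trees. Then $(\mathbf{E}_J)_J$ and $(\mathbf{H}_J)_J$, where $J$ runs over all pairs of twin binary trees, are bases of $\mathbf{Baxter}$, and they are multiplicative: for all pairs of twin binary trees $J_0,J_1$ (of any sizes), $$\mathbf{E}_{J_0}\cdot\mathbf{E}_{J_1}=\mathbf{E}_{J_0\diagup J_1},\qquad \mathbf{H}_{J_0}\cdot\mathbf{H}_{J_1}=\mathbf{H}_{J_0\diagdown J_1}.$$ -/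

import Mathlib

namespace BaxterHopf

/-! ### Words and permutations -/

/-- The shuffle of two words, as the list of its terms. -/
def shuffle : List ℕ → List ℕ → List (List ℕ)
  | [], w => [w]
  | a :: u, [] => [a :: u]
  | a :: u, b :: v =>
      (shuffle u (b :: v)).map (fun w => a :: w) ++ (shuffle (a :: u) v).map (fun w => b :: w)
termination_by u v => u.length + v.length

/-- The word `σ₁ σ₂ … σₙ` (on the letters `1, …, n`) of a permutation of size `n`. -/
def word {n : ℕ} (σ : Equiv.Perm (Fin n)) : List ℕ :=
  List.ofFn fun i => (σ i : ℕ) + 1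

/-- The shifted shuffle of `σ` and `ν`: shuffle of the word of `σ` with the word of `ν` whose
letters are incremented by the size of `σ`. -/
def shiftedShuffle {m n : ℕ} (σ : Equiv.Perm (Fin m)) (ν : Equiv.Perm (Fin n)) :
    List (List ℕ) :=
  shuffle (word σ) ((word ν).map fun a => a + m)

/-- The covering relation of the permutohedron: `σ = u a b v` and `ν = u b a v` with `a < b`. -/
def PermCover {n : ℕ} (σ ν : Equiv.Perm (Fin n)) : Prop :=
  ∃ (u v : List ℕ) (a b : ℕ), a < b ∧ word σ = u ++ a :: b :: v ∧ word ν = u ++ b :: a :: v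

/-- The permutohedron order. -/
def PermLE {n : ℕ} (σ ν : Equiv.Perm (Fin n)) : Prop :=
  Relation.ReflTransGen PermCover σ ν

/-! ### Binary trees, canopies, graftings -/

/-- The orientations of the leaves of a tree, read from left to right: `1` for a leaf that is a
left child, `0` for a leaf that is a right child. The first argument is the value
given to the unique leaf of the empty tree. -/
def leafWord : Fin 2 → BinaryTree Unit → List (Fin 2)
  | d, .nil => [d]
  | _, .node _ l r => leafWord 1 l ++ leafWord 0 r

/-- The canopy: the orientations of all leaves except the first one and the last one.
(The leaf of the empty tree is deleted, so the value `1` chosen for it does not matter.) -/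
def canopy (T : BinaryTree Unit) : List (Fin 2) :=
  (leafWord 1 T).tail.dropLast

/-- `T₀ ╱ T₁`: graft `T₀` from its root on the leftmost leaf of `T₁`. -/
def graftLeft (T₀ : BinaryTree Unit) : BinaryTree Unit → BinaryTree Unit
  | .nil => T₀
  | .node x l r => .node x (graftLeft T₀ l) r

/-- `T₀ ╲ T₁`: graft `T₁` from its root on the rightmost leaf of `T₀`. -/
def graftRight : BinaryTree Unit → BinaryTree Unit → BinaryTree Unit
  | .nil, T₁ => T₁
  | .node x l r, T₁ => .node x l (graftRight r T₁)

theorem numNodes_graftLeft (T₀ T₁ : BinaryTree Unit) :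
    (graftLeft T₀ T₁).numNodes = T₀.numNodes + T₁.numNodes := by
  induction T₁ with
  | nil => simp [graftLeft]
  | node x l r hl _ => simp only [graftLeft, BinaryTree.numNodes, hl]; omega

theorem numNodes_graftRight (T₀ T₁ : BinaryTree Unit) :
    (graftRight T₀ T₁).numNodes = T₀.numNodes + T₁.numNodes := by
  induction T₀ with
  | nil => simp [graftRight]
  | node x l r _ hr => simp only [graftRight, BinaryTree.numNodes, hr]; omega

theorem leafWord_ne_nil (d : Fin 2) (T : BinaryTree Unit) : leafWord d T ≠ [] := by
  induction T generalizing d with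
  | nil => simp [leafWord]
  | node x l r hl _ => simp [leafWord, hl]

theorem leafWord_node (x : Unit) (l r : BinaryTree Unit) (d : Fin 2) :
    leafWord d (.node x l r) = 1 :: (canopy (.node x l r) ++ [0]) := by
  have hd : ∀ T : BinaryTree Unit, (leafWord 1 T).head? = some 1 := by
    intro T
    induction T with
    | nil => simp [leafWord]
    | node x l r hl _ => simp [leafWord, List.head?_append, hl]
  have hlast : ∀ T : BinaryTree Unit, (leafWord 0 T).getLast? = some 0 := by
    intro T
    induction T with
    | nil => simp [leafWord]
    | node x l r _ hr => simp [leafWord, List.getLast?_append, hr]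
  have h1 := hd l
  have h2 := hlast r
  simp only [canopy, leafWord]
  obtain ⟨a, s, hs⟩ := List.exists_cons_of_ne_nil (leafWord_ne_nil 1 l)
  obtain ⟨b, t, ht⟩ : ∃ b t, leafWord 0 r = t ++ [b] :=
    ⟨_, _, (List.dropLast_append_getLast (leafWord_ne_nil 0 r)).symm⟩
  rw [hs] at h1
  rw [ht] at h2
  simp only [List.head?_cons, Option.some.injEq] at h1
  simp only [List.getLast?_append, List.getLast?_singleton, Option.some_or,
    Option.some.injEq] at h2
  subst h1 h2
  rw [hs, ht]
  simp [← List.append_assoc]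

theorem leafWord_graftLeft (T₀ l r : BinaryTree Unit) (x : Unit) (d : Fin 2) :
    leafWord d (graftLeft T₀ (.node x l r))
      = leafWord 1 T₀ ++ (leafWord d (.node x l r)).tail := by
  induction l generalizing r x d with
  | nil => simp [graftLeft, leafWord]
  | node y a b ha _ =>
    have h := ha b y 1
    have e : leafWord d (.node x (.node y a b) r) = leafWord 1 (.node y a b) ++ leafWord 0 r := rfl
    rw [graftLeft, leafWord, h, e, List.tail_append_of_ne_nil (leafWord_ne_nil _ _),
      List.append_assoc]

theorem leafWord_graftRight (l r T₁ : BinaryTree Unit) (x : Unit) (d : Fin 2) :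
    leafWord d (graftRight (.node x l r) T₁)
      = (leafWord d (.node x l r)).dropLast ++ leafWord 0 T₁ := by
  induction r generalizing l x d with
  | nil => simp [graftRight, leafWord]
  | node y a b _ hb =>
    have h := hb a y 0
    have e : leafWord d (.node x l (.node y a b)) = leafWord 1 l ++ leafWord 0 (.node y a b) := rfl
    rw [graftRight, leafWord, h, e, List.dropLast_append_of_ne_nil (leafWord_ne_nil _ _),
      List.append_assoc]

theorem graftLeft_nil_left (T : BinaryTree Unit) : graftLeft .nil T = T := by
  induction T with
  | nil => rfl
  | node x l r hl _ => rw [graftLeft, hl]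

theorem graftRight_nil_right (T : BinaryTree Unit) : graftRight T .nil = T := by
  induction T with
  | nil => rfl
  | node x l r _ hr => rw [graftRight, hr]

theorem canopy_graftLeft (x y : Unit) (a b c d : BinaryTree Unit) :
    canopy (graftLeft (.node x a b) (.node y c d))
      = canopy (.node x a b) ++ 0 :: canopy (.node y c d) := by
  rw [canopy, leafWord_graftLeft, leafWord_node, leafWord_node,
    List.tail_cons, List.cons_append, List.tail_cons, List.append_assoc, List.singleton_append,
    ← List.cons_append, ← List.append_assoc, List.dropLast_concat]

theorem canopy_graftRight (x y : Unit) (a b c d : BinaryTree Unit) :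
    canopy (graftRight (.node x a b) (.node y c d))
      = canopy (.node x a b) ++ 1 :: canopy (.node y c d) := by
  rw [canopy, leafWord_graftRight, leafWord_node, leafWord_node,
    ← List.cons_append, List.dropLast_concat, List.cons_append, List.tail_cons,
    ← List.cons_append, ← List.append_assoc, List.dropLast_concat]

/-! ### Pairs of twin binary trees -/

/-- Pairs of twin binary trees with `n` nodes each: the canopies are complementary. -/
@[ext]
structure TBT (n : ℕ) where
  left : BinaryTree Unit
  right : BinaryTree Unit
  numNodes_left : left.numNodes = n
  numNodes_right : right.numNodes = n
  twin : List.Forall₂ (fun a b => a ≠ b) (canopy left) (canopy right)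

noncomputable instance (n : ℕ) : Fintype (TBT n) :=
  Fintype.ofInjective
    (fun J : TBT n =>
      ((⟨J.left, BinaryTree.mem_treesOfNumNodesEq.2 J.numNodes_left⟩,
        ⟨J.right, BinaryTree.mem_treesOfNumNodesEq.2 J.numNodes_right⟩) :
        {T // T ∈ BinaryTree.treesOfNumNodesEq n} × {T // T ∈ BinaryTree.treesOfNumNodesEq n}))
    (by
      intro J J' h
      simp only [Prod.mk.injEq, Subtype.mk.injEq] at h
      exact TBT.ext h.1 h.2)

theorem twin_graft {L₀ R₀ L₁ R₁ : BinaryTree Unit} (h₀ : L₀.numNodes = R₀.numNodes)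
    (h₁ : L₁.numNodes = R₁.numNodes)
    (t₀ : List.Forall₂ (fun a b => a ≠ b) (canopy L₀) (canopy R₀))
    (t₁ : List.Forall₂ (fun a b => a ≠ b) (canopy L₁) (canopy R₁)) :
    List.Forall₂ (fun a b => a ≠ b) (canopy (graftRight L₀ L₁)) (canopy (graftLeft R₀ R₁)) ∧
    List.Forall₂ (fun a b => a ≠ b) (canopy (graftLeft L₀ L₁)) (canopy (graftRight R₀ R₁)) := by
  rcases L₀ with _ | ⟨x, a, b⟩ <;> rcases R₀ with _ | ⟨x', a', b'⟩
  · simpa [graftLeft_nil_left, graftRight] using t₁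
  · simp at h₀
  · simp at h₀
  rcases L₁ with _ | ⟨y, c, d⟩ <;> rcases R₁ with _ | ⟨y', c', d'⟩
  · simpa only [graftRight_nil_right, graftLeft, and_self] using t₀
  · simp at h₁
  · simp at h₁
  rw [canopy_graftLeft, canopy_graftRight, canopy_graftLeft, canopy_graftRight]
  exact ⟨List.rel_append t₀ (.cons (by decide) t₁), List.rel_append t₀ (.cons (by decide) t₁)⟩

/-- `J₀ ╱ J₁ = (L₀ ╲ L₁, R₀ ╱ R₁)`. -/
def TBT.over {m n : ℕ} (J₀ : TBT m) (J₁ : TBT n) : TBT (m + n) where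
  left := graftRight J₀.left J₁.left
  right := graftLeft J₀.right J₁.right
  numNodes_left := by rw [numNodes_graftRight, J₀.numNodes_left, J₁.numNodes_left]
  numNodes_right := by rw [numNodes_graftLeft, J₀.numNodes_right, J₁.numNodes_right]
  twin := (twin_graft (J₀.numNodes_left.trans J₀.numNodes_right.symm)
    (J₁.numNodes_left.trans J₁.numNodes_right.symm) J₀.twin J₁.twin).1

/-- `J₀ ╲ J₁ = (L₀ ╱ L₁, R₀ ╲ R₁)`. -/
def TBT.under {m n : ℕ} (J₀ : TBT m) (J₁ : TBT n) : TBT (m + n) where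
  left := graftLeft J₀.left J₁.left
  right := graftRight J₀.right J₁.right
  numNodes_left := by rw [numNodes_graftLeft, J₀.numNodes_left, J₁.numNodes_left]
  numNodes_right := by rw [numNodes_graftRight, J₀.numNodes_right, J₁.numNodes_right]
  twin := (twin_graft (J₀.numNodes_left.trans J₀.numNodes_right.symm)
    (J₁.numNodes_left.trans J₁.numNodes_right.symm) J₀.twin J₁.twin).2

/-! ### The insertion algorithm -/

/-- Leaf insertion of a letter into a left binary search tree. -/
def leafInsert (a : ℕ) : BinaryTree ℕ → BinaryTree ℕ
  | .nil => .node a .nil .nil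
  | .node b l r => if a < b then .node b (leafInsert a l) r else .node b l (leafInsert a r)

/-- The lower restricted tree `T_{≤ b}` of a right binary search tree `T`: the nodes with label
`≤ b`, with the ancestor relation of `T` (if the root label is `≤ b`, so are all labels of the left
subtree; otherwise all labels of the right subtree are `> b`). -/
def lowerRestrict (b : ℕ) : BinaryTree ℕ → BinaryTree ℕ
  | .nil => .nil
  | .node x l r => if x ≤ b then .node x l (lowerRestrict b r) else lowerRestrict b l

/-- The higher restricted tree `T_{> b}` of a right binary search tree `T`. -/
def higherRestrict (b : ℕ) : BinaryTree ℕ → BinaryTree ℕ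
  | .nil => .nil
  | .node x l r => if x ≤ b then higherRestrict b r else .node x (higherRestrict b l) r

/-- Root insertion of a letter into a right binary search tree. -/
def rootInsert (a : ℕ) (T : BinaryTree ℕ) : BinaryTree ℕ :=
  .node a (lowerRestrict a T) (higherRestrict a T)

/-- The `ℙ`-symbol of a word: insert its letters, from left to right, into the pair of empty
trees, by leaf insertion in the left tree and by root insertion in the right tree. -/
def pSymbol (u : List ℕ) : BinaryTree ℕ × BinaryTree ℕ :=
  u.foldl (fun T a => (leafInsert a T.1, rootInsert a T.2)) (.nil, .nil)

/-- The shape of a labeled tree. -/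
def shape (T : BinaryTree ℕ) : BinaryTree Unit := T.map fun _ => ()

/-- The (shape of the) `ℙ`-symbol of the permutation `σ` is the pair `J`. -/
def HasPSymbol {n : ℕ} (σ : Equiv.Perm (Fin n)) (J : TBT n) : Prop :=
  shape (pSymbol (word σ)).1 = J.left ∧ shape (pSymbol (word σ)).2 = J.right

/-- The order `≤_B` on pairs of twin binary trees. -/
def TBT.LE {n : ℕ} (J₀ J₁ : TBT n) : Prop :=
  ∃ σ₀ σ₁ : Equiv.Perm (Fin n), HasPSymbol σ₀ J₀ ∧ HasPSymbol σ₁ J₁ ∧ PermLE σ₀ σ₁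

/-! ### The algebras `FQSym` and `Baxter` -/

/-- The underlying space of `FQSym`: the vector space with basis the permutations of all sizes. -/
def FQSym (K : Type*) [Field K] : Type _ := (Σ n : ℕ, Equiv.Perm (Fin n)) →₀ K

section

variable (K : Type*) [Field K]

noncomputable instance : AddCommGroup (FQSym K) :=
  inferInstanceAs (AddCommGroup ((Σ n : ℕ, Equiv.Perm (Fin n)) →₀ K))

noncomputable instance : Module K (FQSym K) :=
  inferInstanceAs (Module K ((Σ n : ℕ, Equiv.Perm (Fin n)) →₀ K))

/-- The fundamental basis element `F_σ`. -/
noncomputable def F {n : ℕ} (σ : Equiv.Perm (Fin n)) : FQSym K :=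
  (Finsupp.single (⟨n, σ⟩ : Σ n : ℕ, Equiv.Perm (Fin n)) (1 : K) :
    (Σ n : ℕ, Equiv.Perm (Fin n)) →₀ K)

/-- The product `F_σ · F_ν`: the sum of the `F_π` for `π` in the shifted shuffle of `σ` and `ν`.
(The two words that are shuffled have no common letter, so every term occurs only once.) -/
noncomputable def mulBasis {m n : ℕ} (σ : Equiv.Perm (Fin m)) (ν : Equiv.Perm (Fin n)) :
    FQSym K :=
  ∑ π : Equiv.Perm (Fin (m + n)) with word π ∈ shiftedShuffle σ ν, F K π

/-- The product of `FQSym`: the bilinear extension of `mulBasis`. -/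
noncomputable instance : Mul (FQSym K) where
  mul x y :=
    Finsupp.sum (show (Σ n : ℕ, Equiv.Perm (Fin n)) →₀ K from x) fun σ a =>
      Finsupp.sum (show (Σ n : ℕ, Equiv.Perm (Fin n)) →₀ K from y) fun ν b =>
        (a * b) • mulBasis K σ.2 ν.2

open Classical in
/-- `P_J`, the sum of the `F_σ` with `ℙ(σ) = J`. -/
noncomputable def P {n : ℕ} (J : TBT n) : FQSym K :=
  ∑ σ : Equiv.Perm (Fin n) with HasPSymbol σ J, F K σ

/-- `Baxter`, the subspace of `FQSym` spanned by the `P_J`. -/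
noncomputable def Baxter : Submodule K (FQSym K) :=
  Submodule.span K (Set.range fun J : (Σ n : ℕ, TBT n) => P K J.2)

open Classical in
/-- The elementary family `E_J`, the sum of the `P_{J'}` with `J ≤_B J'`. -/
noncomputable def E {n : ℕ} (J : TBT n) : FQSym K :=
  ∑ J' : TBT n with TBT.LE J J', P K J'

open Classical in
/-- The homogeneous family `H_J`, the sum of the `P_{J'}` with `J' ≤_B J`. -/
noncomputable def H {n : ℕ} (J : TBT n) : FQSym K :=
  ∑ J' : TBT n with TBT.LE J' J, P K J'

end

end BaxterHopf

/-!
The nodes of a binary tree are named by consecutive integers in infix order, so that a tree is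
determined by its ancestor relation `IsAncestor`. A permutation `σ` has the `ℙ`-symbol `J` if and
only if it is a linear extension of `J`: ancestors in the left tree come first, ancestors in the
right tree come last (`hasPSymbol_iff`). Call a precedence of two letters *directly forced* by `J`
if it comes from an ancestor pair in one of the two trees (`TBT.Precedes`).

*Elements above `J`.* The key point is `TBT.isBelow_iff`: the `ℙ`-symbol of `τ` is above `J` if and
only if every inversion directly forced by `J` is an inversion of `τ`. One direction holds because
descendants form intervals and inversions grow along the permutohedron order. For the other one,
start from a permutation with `ℙ`-symbol `J` and remove descents as long as the `ℙ`-symbol does not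
change. In the resulting permutation `σ` every descent is directly forced by `J`, which implies that
every inversion of `σ` is an inversion of `τ` (`invLE_of_descents_forced`); and the permutohedron
order is the inclusion of inversion sets (`InvLE.permLE`).

*Products.* Hence `E_J` is the sum of the `F_τ` such that the inversions of `τ` contain those
directly forced by `J`. A permutation `π` of size `m + n` occurs in exactly one shifted shuffle,
that of its restrictions to the letters `≤ m` and `> m`. The inversions directly forced by `J₀ ╱ J₁`
are those forced by `J₀` and, shifted by `m`, those forced by `J₁` (`TBT.precedes_over_iff`), since
the graftings only add ancestor pairs that force noninversions. This gives the product of the `E_J`.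
Reversing words exchanges the two trees and reverses the orders, and gives the product of the `H_J`.

*Bases.* Every pair of twin binary trees is a `ℙ`-symbol (`TBT.exists_perm`): the directly forced
precedences have no cycle, because two successive ones, one increasing and one decreasing, compose
to a directly forced one (`TBT.Precedes.shorten`); the twin condition excludes that the two trees
contradict each other. The least number of inversions of a permutation with `ℙ`-symbol `J` is
strictly increasing in `J` (`TBT.LE.minInv_lt`), so the families `E` and `H` are unitriangular with
respect to the `P_J`.
-/

namespace BaxterHopf

/-! ### The ancestor relation of a binary tree -/

/-- `IsAncestor k T x y`: the node `x` is a proper ancestor of the node `y` in `T`, where the nodes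
of `T` are named `k, k + 1, …` in infix order. -/
def IsAncestor : ℕ → BinaryTree Unit → ℕ → ℕ → Prop
  | _, .nil, _, _ => False
  | k, .node _ l r, x, y =>
      (x = k + l.numNodes ∧ k ≤ y ∧ y < k + l.numNodes + 1 + r.numNodes ∧ y ≠ x) ∨
        IsAncestor k l x y ∨ IsAncestor (k + l.numNodes + 1) r x y

theorem IsAncestor.mem_range {T : BinaryTree Unit} {k x y : ℕ} (h : IsAncestor k T x y) :
    k ≤ x ∧ x < k + T.numNodes ∧ k ≤ y ∧ y < k + T.numNodes ∧ x ≠ y := by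
  induction T generalizing k with
  | nil => exact h.elim
  | node _ l r hl hr =>
    simp only [BinaryTree.numNodes]
    rcases h with h | h | h
    · omega
    · have := hl h; omega
    · have := hr h; omega

/-- The descendants of a node form an interval in infix order. -/
theorem IsAncestor.of_between {T : BinaryTree Unit} {k x y z : ℕ} (h : IsAncestor k T x y)
    (hz : (x < z ∧ z ≤ y) ∨ (y ≤ z ∧ z < x)) : IsAncestor k T x z := by
  induction T generalizing k with
  | nil => exact h.elim
  | node _ l r hl hr =>
    rcases h with h | h | h
    · exact .inl (by omega)
    · exact .inr (.inl (hl h))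
    · exact .inr (.inr (hr h))

/-- Two nodes have a lowest common ancestor, which lies between them. -/
theorem exists_common_ancestor {T : BinaryTree Unit} {k x y : ℕ} (hx : k ≤ x) (hxy : x < y)
    (hy : y < k + T.numNodes) :
    IsAncestor k T x y ∨ IsAncestor k T y x ∨
      ∃ z, x < z ∧ z < y ∧ IsAncestor k T z x ∧ IsAncestor k T z y := by
  induction T generalizing k with
  | nil => simp at hy; omega
  | node _ l r hl hr =>
    simp only [BinaryTree.numNodes] at hy
    rcases lt_trichotomy y (k + l.numNodes) with h | h | h
    · rcases hl hx h with h | h | ⟨z, h⟩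
      · exact .inl (.inr (.inl h))
      · exact .inr (.inl (.inr (.inl h)))
      · exact .inr (.inr ⟨z, h.1, h.2.1, .inr (.inl h.2.2.1), .inr (.inl h.2.2.2)⟩)
    · exact .inr (.inl (.inl (by omega)))
    rcases lt_trichotomy x (k + l.numNodes) with h' | h' | h'
    · exact .inr (.inr ⟨k + l.numNodes, h', h, .inl (by omega), .inl (by omega)⟩)
    · exact .inl (.inl (by omega))
    · rcases hr (k := k + l.numNodes + 1) (by omega) (by omega) with h | h | ⟨z, h⟩
      · exact .inl (.inr (.inr h))
      · exact .inr (.inl (.inr (.inr h)))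
      · exact .inr (.inr ⟨z, h.1, h.2.1, .inr (.inr h.2.2.1), .inr (.inr h.2.2.2)⟩)

theorem IsAncestor.asymm {T : BinaryTree Unit} {k x y : ℕ} (h : IsAncestor k T x y) :
    ¬ IsAncestor k T y x := by
  induction T generalizing k with
  | nil => exact h.elim
  | node _ l r hl hr =>
    rintro (h' | h' | h') <;> rcases h with h | h | h
    · omega
    · have := h.mem_range; omega
    · have := h.mem_range; omega
    · have := h'.mem_range; omega
    · exact hl h h'
    · have := h.mem_range; have := h'.mem_range; omega
    · have := h'.mem_range; omega
    · have := h.mem_range; have := h'.mem_range; omega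
    · exact hr h h'

theorem IsAncestor.trans {T : BinaryTree Unit} {k x y z : ℕ} (h : IsAncestor k T x y)
    (h' : IsAncestor k T y z) : IsAncestor k T x z := by
  induction T generalizing k with
  | nil => exact h.elim
  | node _ l r hl hr =>
    have hr' := IsAncestor.mem_range (T := r) (k := k + l.numNodes + 1) (x := y) (y := z)
    have hl' := IsAncestor.mem_range (T := l) (k := k) (x := y) (y := z)
    rcases h with h | h | h
    · rcases h' with h' | h' | h'
      · omega
      · have := hl' h'; exact .inl (by omega)
      · have := hr' h'; exact .inl (by omega)
    · have := h.mem_range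
      rcases h' with h' | h' | h'
      · omega
      · exact .inr (.inl (hl h h'))
      · have := hr' h'; omega
    · have := h.mem_range
      rcases h' with h' | h' | h'
      · omega
      · have := hl' h'; omega
      · exact .inr (.inr (hr h h'))

/-- A linear order determines at most one tree of a given size whose ancestors come first. -/
theorem eq_of_isAncestor_le {r : ℕ → ℕ → Prop} (hr : ∀ x y, r x y → ¬ r y x)
    {T T' : BinaryTree Unit} {k : ℕ} (hn : T.numNodes = T'.numNodes)
    (h : ∀ x y, IsAncestor k T x y → r x y) (h' : ∀ x y, IsAncestor k T' x y → r x y) :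
    T = T' := by
  induction T generalizing k T' with
  | nil =>
    cases T' with
    | nil => rfl
    | node => simp at hn
  | node u a b ha hb =>
    cases T' with
    | nil => simp at hn
    | node u' a' b' =>
      simp only [BinaryTree.numNodes] at hn
      have hs : a.numNodes = a'.numNodes := by
        by_contra hne
        exact hr _ _ (h (k + a.numNodes) (k + a'.numNodes) (.inl (by omega)))
          (h' (k + a'.numNodes) (k + a.numNodes) (.inl (by omega)))
      rw [ha (k := k) hs (fun x y hxy => h x y (.inr (.inl hxy)))
          (fun x y hxy => h' x y (.inr (.inl hxy))),
        hb (k := k + a.numNodes + 1) (by omega) (fun x y hxy => h x y (.inr (.inr hxy)))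
          (fun x y hxy => h' x y (.inr (.inr (hs ▸ hxy))))]

/-- In the tree of a linear order `r`, the ancestors of `y` are the `x` that come first in the
interval between `x` and `y`. -/
theorem isAncestor_of_forall_between {r : ℕ → ℕ → Prop} (hr : ∀ x y, r x y → ¬ r y x)
    {T : BinaryTree Unit} {k x y : ℕ} (h : ∀ x y, IsAncestor k T x y → r x y)
    (hx : k ≤ x) (hx' : x < k + T.numNodes) (hy : k ≤ y) (hy' : y < k + T.numNodes) (hxy : x ≠ y)
    (hz : ∀ z, (x < z ∧ z ≤ y) ∨ (y ≤ z ∧ z < x) → r x z) : IsAncestor k T x y := by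
  rcases hxy.lt_or_gt with hlt | hlt
  · rcases exists_common_ancestor hx hlt hy' with h1 | h1 | ⟨z, h1, h2, h3, h4⟩
    · exact h1
    · exact (hr _ _ (h _ _ h1) (hz y (by omega))).elim
    · exact (hr _ _ (h _ _ h3) (hz z (by omega))).elim
  · rcases exists_common_ancestor hy hlt hx' with h1 | h1 | ⟨z, h1, h2, h3, h4⟩
    · exact (hr _ _ (h _ _ h1) (hz y (by omega))).elim
    · exact h1
    · exact (hr _ _ (h _ _ h4) (hz z (by omega))).elim

theorem isAncestor_add (T : BinaryTree Unit) (k m x y : ℕ) :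
    IsAncestor (k + m) T (x + m) (y + m) ↔ IsAncestor k T x y := by
  induction T generalizing k with
  | nil => rfl
  | node _ l r hl hr =>
    have e : k + m + l.numNodes + 1 = (k + l.numNodes + 1) + m := by omega
    rw [IsAncestor, IsAncestor, hl, e, hr]
    refine or_congr ?_ Iff.rfl
    omega

/-- Grafting on the rightmost leaf creates no pair of a node and an ancestor with a larger
name. -/
theorem isAncestor_graftRight (S T : BinaryTree Unit) {k x y : ℕ} (hxy : y < x) :
    IsAncestor k (graftRight S T) x y ↔
      IsAncestor k S x y ∨ IsAncestor (k + S.numNodes) T x y := by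
  induction S generalizing k with
  | nil => simp [graftRight, IsAncestor]
  | node _ l r _ hr =>
    have e : k + l.numNodes + 1 + r.numNodes = k + (l.numNodes + r.numNodes + 1) := by omega
    simp only [graftRight, IsAncestor, hr, numNodes_graftRight, BinaryTree.numNodes, e, or_assoc]
    refine or_congr ?_ Iff.rfl
    omega

/-- Grafting on the leftmost leaf creates no pair of a node and an ancestor with a smaller
name. -/
theorem isAncestor_graftLeft (S T : BinaryTree Unit) {k x y : ℕ} (hxy : x < y) :
    IsAncestor k (graftLeft S T) x y ↔
      IsAncestor k S x y ∨ IsAncestor (k + S.numNodes) T x y := by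
  induction T generalizing k with
  | nil => simp [graftLeft, IsAncestor]
  | node _ l r hl _ =>
    have e : k + (S.numNodes + l.numNodes) = k + S.numNodes + l.numNodes := by omega
    simp only [graftLeft, IsAncestor, hl, numNodes_graftLeft, e, or_assoc]
    have hS := IsAncestor.mem_range (T := S) (k := k) (x := x) (y := y)
    constructor
    · rintro (h | h | h | h)
      · exact .inr (.inl (by omega))
      · exact .inl h
      · exact .inr (.inr (.inl h))
      · exact .inr (.inr (.inr h))
    · rintro (h | h | h | h)
      · exact .inr (.inl h)
      · exact .inl (by omega)
      · exact .inr (.inr (.inl h))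
      · exact .inr (.inr (.inr h))

/-! ### Canopies and consecutive nodes -/

theorem length_leafWord (d : Fin 2) (T : BinaryTree Unit) :
    (leafWord d T).length = T.numNodes + 1 := by
  induction T generalizing d with
  | nil => rfl
  | node _ l r hl hr => simp only [leafWord, List.length_append, hl, hr, BinaryTree.numNodes]; omega

/-- The leaf between two consecutive nodes is a left child if and only if the first of them is an
ancestor of the second. -/
theorem getElem?_leafWord (T : BinaryTree Unit) (d : Fin 2) (k i : ℕ) (hi : i + 1 < T.numNodes) :
    ((leafWord d T)[i + 1]? = some 1 ∧ IsAncestor k T (k + i) (k + i + 1)) ∨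
      ((leafWord d T)[i + 1]? = some 0 ∧ IsAncestor k T (k + i + 1) (k + i)) := by
  induction T generalizing d k i with
  | nil => simp at hi
  | node _ l r hl hr =>
    simp only [BinaryTree.numNodes] at hi
    have hlen := length_leafWord 1 l
    rcases lt_trichotomy (i + 1) l.numNodes with h | h | h
    · rw [leafWord, List.getElem?_append_left (by omega)]
      rcases hl 1 k i h with h | h
      · exact .inl ⟨h.1, .inr (.inl h.2)⟩
      · exact .inr ⟨h.1, .inr (.inl h.2)⟩
    · refine .inr ⟨?_, .inl (by omega)⟩
      rw [leafWord, List.getElem?_append_left (by omega)]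
      rcases l with _ | ⟨x, a, b⟩
      · simp at h
      · rw [leafWord_node] at hlen ⊢
        simp only [List.length_cons, List.length_append, List.length_nil] at hlen
        rw [List.getElem?_cons_succ, List.getElem?_append_right (by omega)]
        simp [show i = (canopy (.node x a b)).length by omega]
    · rw [leafWord, List.getElem?_append_right (by omega), hlen]
      rcases Nat.lt_or_ge l.numNodes i with h' | h'
      · obtain ⟨j, rfl⟩ : ∃ j, i = l.numNodes + 1 + j := ⟨i - (l.numNodes + 1), by omega⟩
        have e : l.numNodes + 1 + j + 1 - (l.numNodes + 1) = j + 1 := by omega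
        have e' : k + (l.numNodes + 1 + j) = k + l.numNodes + 1 + j := by omega
        rw [e, e']
        rcases hr 0 (k + l.numNodes + 1) j (by omega) with h | h
        · exact .inl ⟨h.1, .inr (.inr h.2)⟩
        · exact .inr ⟨h.1, .inr (.inr h.2)⟩
      · refine .inl ⟨?_, .inl (by omega)⟩
        rcases r with _ | ⟨x, a, b⟩
        · simp at hi; omega
        · rw [leafWord_node, show i + 1 - (l.numNodes + 1) = 0 by omega]; rfl

theorem length_canopy (T : BinaryTree Unit) : (canopy T).length = T.numNodes - 1 := by
  simp [canopy, length_leafWord]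

theorem getElem?_canopy (T : BinaryTree Unit) (i : ℕ) (hi : i + 1 < T.numNodes) :
    (canopy T)[i]? = (leafWord 1 T)[i + 1]? := by
  rcases T with _ | ⟨x, l, r⟩
  · simp at hi
  · have := length_canopy (.node x l r)
    rw [leafWord_node, List.getElem?_cons_succ, List.getElem?_append_left (by omega)]

/-- The canopies of two trees are complementary if and only if consecutive nodes are related in
opposite ways in the two trees. -/
theorem forall₂_canopy_iff {S T : BinaryTree Unit} {n : ℕ} (k : ℕ) (hS : S.numNodes = n)
    (hT : T.numNodes = n) :
    List.Forall₂ (fun a b => a ≠ b) (canopy S) (canopy T) ↔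
      ∀ i, i + 1 < n → (IsAncestor k S (k + i) (k + i + 1) ↔
        IsAncestor k T (k + i + 1) (k + i)) := by
  have key : ∀ i, i + 1 < n → ((canopy S)[i]? ≠ (canopy T)[i]? ↔
      (IsAncestor k S (k + i) (k + i + 1) ↔ IsAncestor k T (k + i + 1) (k + i))) := by
    intro i hi
    rw [getElem?_canopy S i (by omega), getElem?_canopy T i (by omega)]
    rcases getElem?_leafWord S 1 k i (by omega) with h | h <;>
      rcases getElem?_leafWord T 1 k i (by omega) with h' | h' <;>
      simp [h.1, h'.1, h.2, h'.2, h.2.asymm, h'.2.asymm]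
  have hlS := length_canopy S
  have hlT := length_canopy T
  rw [List.forall₂_iff_get]
  constructor
  · rintro ⟨_, h⟩ i hi
    rw [← key i hi, List.getElem?_eq_getElem (by omega), List.getElem?_eq_getElem (by omega)]
    simpa using h i (by omega) (by omega)
  · intro h
    refine ⟨by omega, fun i hi hi' => ?_⟩
    have := (key i (by omega)).2 (h i (by omega))
    rw [List.getElem?_eq_getElem hi, List.getElem?_eq_getElem hi'] at this
    simpa using this

/-! ### Words and the order of their letters -/

/-- The word `w` contains each of the letters `k, …, k + n - 1` once and no other letter. -/
def IsArrangement (k n : ℕ) (w : List ℕ) : Prop :=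
  w.Nodup ∧ ∀ x, x ∈ w ↔ k ≤ x ∧ x < k + n

/-- The (first) letter `x` of `w` is to the left of the letter `y`. This also holds if `x` is
a letter of `w` and `y` is not. -/
def Before (w : List ℕ) (x y : ℕ) : Prop := w.idxOf x < w.idxOf y

theorem IsArrangement.length_eq {k n : ℕ} {w : List ℕ} (h : IsArrangement k n w) :
    w.length = n := by
  have : w.Perm (List.range' k n) := by
    rw [List.perm_ext_iff_of_nodup h.1 List.nodup_range']
    intro x
    rw [h.2 x, List.mem_range'_1]
  simpa using this.length_eq

theorem Before.asymm {w : List ℕ} (x y : ℕ) (h : Before w x y) : ¬ Before w y x :=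
  Nat.lt_asymm h

theorem before_or_before {w : List ℕ} {x y : ℕ} (hx : x ∈ w) (h : x ≠ y) :
    Before w x y ∨ Before w y x :=
  Nat.lt_or_gt_of_ne fun e => h ((List.idxOf_inj hx).1 e)

theorem before_filter_iff (p : ℕ → Bool) (w : List ℕ) {x y : ℕ} (hx : p x) (hy : p y) :
    Before (w.filter p) x y ↔ Before w x y := by
  unfold Before
  induction w with
  | nil => simp
  | cons a w ih =>
    by_cases ha : p a
    · simp only [List.filter_cons, ha, if_true, List.idxOf_cons]
      simp only [beq_iff_eq, cond_eq_ite]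
      split_ifs <;> omega
    · have h1 : a ≠ x := by rintro rfl; exact ha hx
      have h2 : a ≠ y := by rintro rfl; exact ha hy
      simp [ha, h1, h2, ih]

theorem before_map_add_iff (m : ℕ) (w : List ℕ) (x y : ℕ) :
    Before (w.map fun a => a + m) (x + m) (y + m) ↔ Before w x y := by
  have h : ∀ x, (w.map fun a => a + m).idxOf (x + m) = w.idxOf x := by
    intro x
    induction w with
    | nil => rfl
    | cons a w ih =>
      by_cases h : a = x <;> simp [h, ih]
  rw [Before, h, h, Before]

theorem idxOf_reverse {w : List ℕ} (hw : w.Nodup) {x : ℕ} (hx : x ∈ w) :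
    w.reverse.idxOf x + w.idxOf x + 1 = w.length := by
  induction w with
  | nil => simp at hx
  | cons a w ih =>
    rw [List.nodup_cons] at hw
    by_cases h : a = x
    · subst h
      simp [List.idxOf_append, hw.1]
    · have hx' : x ∈ w := by simpa [Ne.symm h] using hx
      have := ih hw.2 hx'
      simp [List.idxOf_append, h, hx']
      omega

theorem before_reverse_iff {w : List ℕ} (hw : w.Nodup) {x y : ℕ} (hx : x ∈ w) (hy : y ∈ w) :
    Before w.reverse x y ↔ Before w y x := by
  have h1 := idxOf_reverse hw hx
  have h2 := idxOf_reverse hw hy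
  unfold Before
  omega

/-- Exchanging two adjacent letters changes the order of no other pair of letters. -/
theorem before_swap {u v : List ℕ} {a b x y : ℕ} (hab : (u ++ a :: b :: v).Nodup)
    (h : Before (u ++ a :: b :: v) x y) (hxy : ¬ (x = a ∧ y = b)) :
    Before (u ++ b :: a :: v) x y := by
  have hne : a ≠ b := by rintro rfl; simp [List.nodup_append] at hab
  have hau : a ∉ u := fun h => (List.nodup_append.1 hab).2.2 a h a (by simp) rfl
  have hbu : b ∉ u := fun h => (List.nodup_append.1 hab).2.2 b h b (by simp) rfl
  have hlx := List.idxOf_lt_length_iff (l := u) (a := x)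
  have hly := List.idxOf_lt_length_iff (l := u) (a := y)
  unfold Before at *
  simp only [List.idxOf_append, List.idxOf_cons, beq_iff_eq, cond_eq_ite] at *
  grind

/-! ### The two insertions, recursively -/

/-- The left tree of the `ℙ`-symbol. -/
def leafTree (w : List ℕ) : BinaryTree ℕ := w.foldl (fun T a => leafInsert a T) .nil

/-- The right tree of the `ℙ`-symbol. -/
def rootTree (w : List ℕ) : BinaryTree ℕ := w.foldl (fun T a => rootInsert a T) .nil

theorem pSymbol_eq (w : List ℕ) : pSymbol w = (leafTree w, rootTree w) := by
  unfold pSymbol leafTree rootTree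
  generalize (BinaryTree.nil : BinaryTree ℕ) = S
  suffices ∀ T, List.foldl (fun T a => (leafInsert a T.1, rootInsert a T.2)) (S, T) w =
      (List.foldl (fun T a => leafInsert a T) S w, List.foldl (fun T a => rootInsert a T) T w) from
    this S
  induction w generalizing S with
  | nil => simp
  | cons a w ih => intro T; simp only [List.foldl_cons]; exact ih _ _

theorem leafTree_cons (a : ℕ) (w : List ℕ) :
    leafTree (a :: w) =
      .node a (leafTree (w.filter (· < a))) (leafTree (w.filter (¬ · < a))) := by
  suffices ∀ l r, w.foldl (fun T a => leafInsert a T) (.node a l r) =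
      .node a ((w.filter (· < a)).foldl (fun T a => leafInsert a T) l)
        ((w.filter (¬ · < a)).foldl (fun T a => leafInsert a T) r) from this .nil .nil
  induction w with
  | nil => intro l r; rfl
  | cons b w ih =>
    intro l r
    rw [List.foldl_cons, leafInsert]
    by_cases h : b < a
    · simp [h, ih]
    · rw [if_neg h, ih, List.filter_cons_of_neg (by simpa using h),
        List.filter_cons_of_pos (by simpa using h), List.foldl_cons]

theorem rootTree_append (w : List ℕ) (a : ℕ) :
    rootTree (w ++ [a]) = rootInsert a (rootTree w) := by
  simp [rootTree]

/-- Restricting the right tree of a word amounts to restricting the word. -/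
theorem restrict_rootTree (w : List ℕ) (b : ℕ) :
    lowerRestrict b (rootTree w) = rootTree (w.filter (· ≤ b)) ∧
      higherRestrict b (rootTree w) = rootTree (w.filter (¬ · ≤ b)) := by
  induction hn : w.length using Nat.strong_induction_on generalizing w b with
  | _ n ih =>
    rcases w.eq_nil_or_concat' with rfl | ⟨w, a, rfl⟩
    · simp [rootTree, lowerRestrict, higherRestrict]
    · simp only [List.length_append, List.length_singleton] at hn
      have h1 := fun b => ih _ (by omega) w b rfl
      have h2 := fun b c => ih _ (by have := List.length_filter_le (· ≤ c) w; omega)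
        (w.filter (· ≤ c)) b rfl
      have h3 := fun b c => ih _ (by have := List.length_filter_le (¬ · ≤ c) w; omega)
        (w.filter (¬ · ≤ c)) b rfl
      rw [List.filter_append, List.filter_append, rootTree_append, rootInsert, lowerRestrict,
        higherRestrict, (h1 a).1, (h1 a).2, (h2 b a).1, (h2 b a).2, (h3 b a).1, (h3 b a).2]
      by_cases h : a ≤ b
      · have e : [a].filter (¬ · ≤ b) = [] := by simp [h]
        have e' : [a].filter (· ≤ b) = [a] := by simp [h]
        rw [e, e', rootTree_append, rootInsert, (h2 a b).1, (h2 a b).2, if_pos h, if_pos h]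
        simp only [List.filter_filter, List.append_nil]
        refine ⟨?_, ?_⟩ <;> congr 2 <;> ext x <;> grind
      · have e : [a].filter (¬ · ≤ b) = [a] := by simpa using h
        have e' : [a].filter (· ≤ b) = [] := by simp [h]
        rw [e, e', rootTree_append, rootInsert, (h3 a b).1, (h3 a b).2, if_neg h, if_neg h]
        simp only [List.filter_filter, List.append_nil]
        refine ⟨?_, ?_⟩ <;> congr 2 <;> ext x <;> grind

theorem rootTree_concat (w : List ℕ) (a : ℕ) :
    rootTree (w ++ [a]) =
      .node a (rootTree (w.filter (· ≤ a))) (rootTree (w.filter (¬ · ≤ a))) := by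
  rw [rootTree_append, rootInsert, (restrict_rootTree w a).1, (restrict_rootTree w a).2]

/-- Removing the letter `a` from an interval of letters leaves the two intervals of smaller and of
larger letters. The predicate `p` may take any value at `a`, which allows for both `· < a`
and `· ≤ a`. -/
theorem IsArrangement.filter {k n a : ℕ} {w u : List ℕ} (h : IsArrangement k n w)
    (hu : u.Nodup) (hw : ∀ x, x ∈ w ↔ x = a ∨ x ∈ u) (ha : a ∉ u) (p : ℕ → Bool) :
    (∀ x, x ≠ a → (p x ↔ x < a)) →
      IsArrangement k (a - k) (u.filter p) ∧
        IsArrangement (a + 1) (k + n - (a + 1)) (u.filter fun x => ¬ p x) := by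
  intro hp
  have haw := (h.2 a).1 ((hw a).2 (.inl rfl))
  refine ⟨⟨hu.filter _, fun x => ?_⟩, ⟨hu.filter _, fun x => ?_⟩⟩
  all_goals
    have h1 := h.2 x
    have h2 := hw x
    have h3 := hp x
    rw [List.mem_filter]
    by_cases hx : x = a
    · subst hx
      simp only [ha, false_and, false_iff]; omega
    · have h4 := h3 hx
      by_cases hpx : p x <;> simp only [hpx, and_true, and_false, true_iff, not_true,
        not_false_iff, reduceCtorEq] at h4 ⊢ <;> grind

/-- The left tree of a word is a tree in which ancestors come first. -/
theorem leafTree_spec {k n : ℕ} {w : List ℕ} (hw : IsArrangement k n w) :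
    (shape (leafTree w)).numNodes = n ∧
      ∀ x y, IsAncestor k (shape (leafTree w)) x y → Before w x y := by
  induction n using Nat.strong_induction_on generalizing k w with
  | _ n ih =>
    rcases w with _ | ⟨a, u⟩
    · exact ⟨hw.length_eq, fun x y h => h.elim⟩
    have ha := (hw.2 a).1 (by simp)
    have hau : a ∉ u := (List.nodup_cons.1 hw.1).1
    obtain ⟨h1, h2⟩ := hw.filter (a := a) (u := u) (List.nodup_cons.1 hw.1).2 (fun x => by simp)
      hau (fun x => decide (x < a)) (by simp)
    obtain ⟨l1, l2⟩ := ih _ (by omega) h1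
    obtain ⟨r1, r2⟩ := ih _ (by omega) h2
    simp only [decide_eq_true_eq] at r1 r2
    rw [leafTree_cons]
    have e : shape (.node a (leafTree (u.filter (· < a))) (leafTree (u.filter (¬ · < a)))) =
      .node () (shape (leafTree (u.filter (· < a)))) (shape (leafTree (u.filter (¬ · < a)))) := rfl
    rw [e]
    refine ⟨by simp only [BinaryTree.numNodes, l1, r1]; omega, ?_⟩
    have hcons : ∀ x y, x ≠ a → y ≠ a → Before u x y → Before (a :: u) x y := by
      intro x y hx hy h
      simpa [Before, List.idxOf_cons, Ne.symm hx, Ne.symm hy] using h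
    rintro x y (h | h | h)
    · rw [l1] at h
      have : x = a := by omega
      have hy : a ≠ y := by omega
      subst this
      simp [Before, hy]
    · have hr := h.mem_range
      refine hcons x y (by omega) (by omega) ?_
      exact (before_filter_iff _ u (by simp; omega) (by simp; omega)).1 (l2 x y h)
    · have hr := h.mem_range
      rw [l1, show k + (a - k) + 1 = a + 1 by omega] at h
      refine hcons x y (by omega) (by omega) ?_
      exact (before_filter_iff _ u (by simp; omega) (by simp; omega)).1 (r2 x y h)

/-- The right tree of a word is a tree in which ancestors come last. -/
theorem rootTree_spec {k n : ℕ} {w : List ℕ} (hw : IsArrangement k n w) :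
    (shape (rootTree w)).numNodes = n ∧
      ∀ x y, IsAncestor k (shape (rootTree w)) x y → Before w y x := by
  induction n using Nat.strong_induction_on generalizing k w with
  | _ n ih =>
    rcases w.eq_nil_or_concat' with rfl | ⟨u, a, rfl⟩
    · exact ⟨hw.length_eq, fun x y h => h.elim⟩
    have hnd := List.nodup_append.1 hw.1
    have ha := (hw.2 a).1 (by simp)
    have hau : a ∉ u := fun h => hnd.2.2 a h a (by simp) rfl
    obtain ⟨h1, h2⟩ := hw.filter (a := a) (u := u) hnd.1 (fun x => by simp [or_comm])
      hau (fun x => decide (x ≤ a)) (by intro x hx; simp; omega)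
    obtain ⟨l1, l2⟩ := ih _ (by omega) h1
    obtain ⟨r1, r2⟩ := ih _ (by omega) h2
    simp only [decide_eq_true_eq] at r1 r2
    rw [rootTree_concat]
    have e : shape (.node a (rootTree (u.filter (· ≤ a))) (rootTree (u.filter (¬ · ≤ a)))) =
      .node () (shape (rootTree (u.filter (· ≤ a)))) (shape (rootTree (u.filter (¬ · ≤ a)))) := rfl
    rw [e]
    refine ⟨by simp only [BinaryTree.numNodes, l1, r1]; omega, ?_⟩
    have hmem : ∀ x, k ≤ x → x < k + n → x ≠ a → x ∈ u := fun x h h' hx => by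
      simpa [hx] using (hw.2 x).2 ⟨h, h'⟩
    have happ : ∀ x y, x ∈ u → y ∈ u → Before u x y → Before (u ++ [a]) x y := by
      intro x y hx hy h
      simpa [Before, List.idxOf_append, hx, hy] using h
    rintro x y (h | h | h)
    · rw [l1, r1] at h
      have : x = a := by omega
      have hy : y ∈ u := hmem y (by omega) (by omega) (by omega)
      subst this
      simpa [Before, List.idxOf_append, hy, hau] using List.idxOf_lt_length_iff.2 hy
    · have hr := h.mem_range
      refine happ _ _ (hmem y (by omega) (by omega) (by omega))
        (hmem x (by omega) (by omega) (by omega)) ?_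
      exact (before_filter_iff _ u (by simp; omega) (by simp; omega)).1 (l2 x y h)
    · have hr := h.mem_range
      rw [l1, show k + (a - k) + 1 = a + 1 by omega] at h
      refine happ _ _ (hmem y (by omega) (by omega) (by omega))
        (hmem x (by omega) (by omega) (by omega)) ?_
      exact (before_filter_iff _ u (by simp; omega) (by simp; omega)).1 (r2 x y h)

/-! ### Permutations and their words -/

theorem isArrangement_word {n : ℕ} (σ : Equiv.Perm (Fin n)) : IsArrangement 1 n (word σ) := by
  refine ⟨List.nodup_ofFn.2 fun i j h => ?_, fun x => ?_⟩
  · exact σ.injective (Fin.ext (by simpa using h))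
  · rw [word, List.mem_ofFn]
    constructor
    · rintro ⟨i, rfl⟩
      have := (σ i).2
      omega
    · intro h
      exact ⟨σ.symm ⟨x - 1, by omega⟩, by simp; omega⟩

theorem exists_word_eq {n : ℕ} {w : List ℕ} (h : IsArrangement 1 n w) :
    ∃ σ : Equiv.Perm (Fin n), word σ = w := by
  have hl := h.length_eq
  have hr : ∀ i : Fin n, 1 ≤ w[i] ∧ w[i] < 1 + n := fun i => (h.2 _).1 (List.getElem_mem _)
  let f : Fin n → Fin n := fun i => ⟨w[i] - 1, by have := hr i; omega⟩
  have hf : Function.Injective f := by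
    intro i j hij
    have h1 := hr i
    have h2 := hr j
    have h3 : w[i] - 1 = w[j] - 1 := congrArg Fin.val hij
    exact Fin.ext ((h.1.getElem_inj_iff (hi := by omega) (hj := by omega)).1
      (show w[i] = w[j] by omega))
  refine ⟨Equiv.ofBijective f (Finite.injective_iff_bijective.1 hf), ?_⟩
  refine List.ext_getElem (by simp [word, hl]) fun i h1 h2 => ?_
  have := hr ⟨i, by omega⟩
  simp only [word, List.getElem_ofFn, Equiv.ofBijective_apply, f]
  simp only [Fin.getElem_fin] at this
  simp only [Fin.getElem_fin]
  omega

theorem word_injective {n : ℕ} : Function.Injective (word : Equiv.Perm (Fin n) → List ℕ) := by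
  intro σ τ h
  ext i
  have := congrFun (List.ofFn_injective h) i
  simpa using this

/-- Two permutations that order the letters in the same way are equal. -/
theorem eq_of_before {n : ℕ} {σ τ : Equiv.Perm (Fin n)}
    (h : ∀ x ∈ word σ, ∀ y ∈ word σ, Before (word σ) x y → Before (word τ) x y) : σ = τ := by
  have hp : ∀ ρ : Equiv.Perm (Fin n), (word ρ).Pairwise (Before (word ρ)) := by
    intro ρ
    rw [List.pairwise_iff_getElem]
    intro i j hi hj hij
    rw [Before, (isArrangement_word ρ).1.idxOf_getElem, (isArrangement_word ρ).1.idxOf_getElem]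
    exact hij
  apply word_injective
  refine List.Perm.eq_of_pairwise (le := Before (word τ))
    (fun a b _ _ h1 h2 => (Before.asymm _ _ h1 h2).elim) ?_ (hp τ) ?_
  · exact (hp σ).imp_of_mem fun ha hb => h _ ha _ hb
  · rw [List.perm_ext_iff_of_nodup (isArrangement_word σ).1 (isArrangement_word τ).1]
    intro x
    rw [(isArrangement_word σ).2, (isArrangement_word τ).2]

/-- The letter of `w` at the position `i`. -/
def letter (w : List ℕ) (i : ℕ) : ℕ := w.getD i 0

theorem letter_idxOf {n : ℕ} {w : List ℕ} (h : IsArrangement 1 n w) {x : ℕ} (hx : 1 ≤ x)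
    (hx' : x ≤ n) : w.idxOf x < n ∧ letter w (w.idxOf x) = x := by
  have := List.idxOf_lt_length_iff.2 ((h.2 x).2 ⟨hx, by omega⟩)
  refine ⟨h.length_eq ▸ this, ?_⟩
  rw [letter, List.getD_eq_getElem _ _ this, List.getElem_idxOf]

theorem idxOf_letter {n : ℕ} {w : List ℕ} (h : IsArrangement 1 n w) {i : ℕ} (hi : i < n) :
    1 ≤ letter w i ∧ letter w i ≤ n ∧ w.idxOf (letter w i) = i := by
  have hl := h.length_eq
  rw [letter, List.getD_eq_getElem _ _ (by omega)]
  have := (h.2 w[i]).1 (List.getElem_mem _)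
  exact ⟨this.1, by omega, h.1.idxOf_getElem i (by omega)⟩

theorem eq_take_letter_letter_drop {n : ℕ} {w : List ℕ} (h : IsArrangement 1 n w) {k : ℕ}
    (hk : k + 1 < n) :
    w = w.take k ++ letter w k :: letter w (k + 1) :: w.drop (k + 2) := by
  have hl := h.length_eq
  rw [letter, letter, List.getD_eq_getElem _ _ (by omega), List.getD_eq_getElem _ _ (by omega),
    List.getElem_cons_drop, List.getElem_cons_drop, List.take_append_drop]

/-- Exchanging the letters of `σ` at the positions `k` and `k + 1`. -/
theorem exists_adjacent_swap {n : ℕ} (σ : Equiv.Perm (Fin n)) {k : ℕ} (hk : k + 1 < n) :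
    ∃ σ' : Equiv.Perm (Fin n),
      (letter (word σ) k < letter (word σ) (k + 1) → PermCover σ σ') ∧
      (∀ x y, ¬ (x = letter (word σ) k ∧ y = letter (word σ) (k + 1)) →
        Before (word σ) x y → Before (word σ') x y) ∧
      (∀ x y, ¬ (x = letter (word σ) (k + 1) ∧ y = letter (word σ) k) →
        Before (word σ') x y → Before (word σ) x y) ∧
      Before (word σ') (letter (word σ) (k + 1)) (letter (word σ) k) := by
  have hσ := isArrangement_word σ
  have hw := eq_take_letter_letter_drop hσ hk
  set a := letter (word σ) k with ha
  set b := letter (word σ) (k + 1) with hb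
  set u := (word σ).take k
  set v := (word σ).drop (k + 2)
  have hab : a ≠ b := by
    intro e
    have h1 := (idxOf_letter hσ (i := k) (by omega)).2.2
    have h2 := (idxOf_letter hσ hk).2.2
    rw [← ha] at h1
    rw [← hb, ← e] at h2
    omega
  have hperm : (u ++ b :: a :: v).Perm (word σ) := by
    rw [hw]; exact (List.Perm.swap _ _ _).append_left _
  obtain ⟨σ', hσ'⟩ := exists_word_eq (n := n) (w := u ++ b :: a :: v)
    ⟨hperm.nodup_iff.2 hσ.1, fun x => by rw [hperm.mem_iff, hσ.2]⟩
  have h3 : ∀ x y, ¬ (x = b ∧ y = a) → Before (word σ') x y → Before (word σ) x y := by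
    intro x y hxy h
    rw [hw]
    rw [hσ'] at h
    exact before_swap (hperm.nodup_iff.2 hσ.1) h hxy
  have h4 : b ∈ word σ' := by rw [hσ']; simp
  refine ⟨σ', fun h => ⟨u, v, a, b, h, hw, hσ'⟩, fun x y hxy h => ?_, h3, ?_⟩
  · rw [hσ']
    rw [hw] at h
    exact before_swap (hw ▸ hσ.1) h hxy
  · refine (before_or_before h4 hab.symm).resolve_right fun h => ?_
    have h1 := (idxOf_letter hσ (i := k) (by omega)).2.2
    have h2 := (idxOf_letter hσ hk).2.2
    rw [hσ'] at h
    -- the prefix `u` contains neither letter, so `b` has position `k` and `a` position `k + 1`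
    have hau : a ∉ u := fun h => (List.nodup_append.1 (hw ▸ hσ.1)).2.2 a h a (by simp) rfl
    have hbu : b ∉ u := fun h => (List.nodup_append.1 (hw ▸ hσ.1)).2.2 b h b (by simp) rfl
    simp [Before, List.idxOf_append, hau, hbu, hab.symm] at h

/-! ### The permutohedron order and inversions -/

/-- Every inversion of `σ` is an inversion of `τ`. -/
def InvLE {n : ℕ} (σ τ : Equiv.Perm (Fin n)) : Prop :=
  ∀ a c, a < c → Before (word σ) c a → Before (word τ) c a

open Classical in
/-- The inversions of `σ`, as pairs of letters. -/
noncomputable def invSet {n : ℕ} (σ : Equiv.Perm (Fin n)) : Finset (ℕ × ℕ) :=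
  {p ∈ Finset.Icc 1 n ×ˢ Finset.Icc 1 n | p.1 < p.2 ∧ Before (word σ) p.2 p.1}

theorem InvLE.invSet_subset {n : ℕ} {σ τ : Equiv.Perm (Fin n)} (h : InvLE σ τ) :
    invSet σ ⊆ invSet τ := by
  intro p hp
  simp only [invSet, Finset.mem_filter] at hp ⊢
  exact ⟨hp.1, hp.2.1, h _ _ hp.2.1 hp.2.2⟩

theorem mem_invSet_letter {n : ℕ} {σ τ : Equiv.Perm (Fin n)} {i j : ℕ} (hi : i < n) (hj : j < n) :
    (letter (word σ) i, letter (word σ) j) ∈ invSet τ ↔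
      letter (word σ) i < letter (word σ) j ∧
        Before (word τ) (letter (word σ) j) (letter (word σ) i) := by
  have h1 := idxOf_letter (isArrangement_word σ) hi
  have h2 := idxOf_letter (isArrangement_word σ) hj
  simp [invSet, h1, h2]

theorem PermLE.invLE {n : ℕ} {σ τ : Equiv.Perm (Fin n)} (h : PermLE σ τ) : InvLE σ τ := by
  induction h with
  | refl => exact fun _ _ _ h => h
  | tail _ hc ih =>
    intro a c hac h
    obtain ⟨u, v, x, y, hxy, h1, h2⟩ := hc
    rw [h2]
    have h3 := ih a c hac h
    rw [h1] at h3
    exact before_swap (h1 ▸ (isArrangement_word _).1) h3 (by omega)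

theorem letter_lt_or_gt {n : ℕ} {w : List ℕ} (h : IsArrangement 1 n w) {i j : ℕ} (hi : i < n)
    (hj : j < n) (hij : i ≠ j) : letter w i < letter w j ∨ letter w j < letter w i := by
  refine Nat.lt_or_gt_of_ne fun e => hij ?_
  rw [← (idxOf_letter h hi).2.2, e, (idxOf_letter h hj).2.2]

/-- The permutohedron order is the inclusion of inversion sets. -/
theorem InvLE.permLE {n : ℕ} {σ τ : Equiv.Perm (Fin n)} (h : InvLE σ τ) : PermLE σ τ := by
  induction hN : (invSet τ \ invSet σ).card using Nat.strong_induction_on generalizing σ with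
  | _ N ih =>
  have hσ := isArrangement_word σ
  have hτ := isArrangement_word τ
  by_cases hk : ∀ k, k + 1 < n → Before (word τ) (letter (word σ) k) (letter (word σ) (k + 1))
  · have hmono : ∀ i j, i < j → j < n → Before (word τ) (letter (word σ) i) (letter (word σ) j) := by
      intro i j hij
      induction j, hij using Nat.le_induction with
      | base => exact hk i
      | succ j hij ih => exact fun hj => (ih (by omega)).trans (hk j hj)
    have : σ = τ := by
      apply eq_of_before
      intro x hx y hy hxy
      have h1 := (hσ.2 x).1 hx
      have h2 := (hσ.2 y).1 hy
      have h3 := letter_idxOf hσ h1.1 (by omega)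
      have h4 := letter_idxOf hσ h2.1 (by omega)
      rw [← h3.2, ← h4.2]
      exact hmono _ _ hxy h4.1
    subst this
    exact .refl
  · push Not at hk
    obtain ⟨k, hk, hb⟩ := hk
    obtain ⟨σ', h1, h2, h3, h4⟩ := exists_adjacent_swap σ hk
    have hne := letter_lt_or_gt hσ (i := k) (j := k + 1) (by omega) hk (by omega)
    have hmem : letter (word σ) k ∈ word τ := by
      have := idxOf_letter hσ (i := k) (by omega)
      rw [hτ.2]; omega
    have hb' := (before_or_before (y := letter (word σ) (k + 1)) hmem (by omega)).resolve_left hb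
    have hbσ : Before (word σ) (letter (word σ) k) (letter (word σ) (k + 1)) := by
      rw [Before, (idxOf_letter hσ (i := k) (by omega)).2.2, (idxOf_letter hσ hk).2.2]; omega
    have hlt : letter (word σ) k < letter (word σ) (k + 1) := by
      refine hne.resolve_right fun hgt => hb (h _ _ hgt hbσ)
    have hle : InvLE σ' τ := by
      intro a c hac hca
      by_cases e : c = letter (word σ) (k + 1) ∧ a = letter (word σ) k
      · rw [e.1, e.2]; exact hb'
      · exact h a c hac (h3 _ _ e hca)
    have hle' : InvLE σ σ' := fun a c hac hca => h2 _ _ (by omega) hca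
    refine Relation.ReflTransGen.head (h1 hlt) (ih _ ?_ hle rfl)
    rw [← hN]
    apply Finset.card_lt_card
    refine (Finset.ssubset_iff_of_subset (Finset.sdiff_subset_sdiff subset_rfl
      hle'.invSet_subset)).2 ⟨(letter (word σ) k, letter (word σ) (k + 1)), ?_, ?_⟩
    · simp only [Finset.mem_sdiff, mem_invSet_letter (show k < n by omega) hk]
      exact ⟨⟨hlt, hb'⟩, fun h => Before.asymm _ _ hbσ h.2⟩
    · simp only [Finset.mem_sdiff, mem_invSet_letter (show k < n by omega) hk]
      exact fun h => h.2 ⟨hlt, h4⟩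

/-! ### The permutations with a given pair of twin binary trees -/

/-- A permutation has the `ℙ`-symbol `J` if and only if it is a linear extension: ancestors come
first for the left tree and last for the right tree. -/
theorem hasPSymbol_iff {n : ℕ} {σ : Equiv.Perm (Fin n)} {J : TBT n} :
    HasPSymbol σ J ↔ (∀ x y, IsAncestor 1 J.left x y → Before (word σ) x y) ∧
      (∀ x y, IsAncestor 1 J.right x y → Before (word σ) y x) := by
  obtain ⟨l1, l2⟩ := leafTree_spec (isArrangement_word σ)
  obtain ⟨r1, r2⟩ := rootTree_spec (isArrangement_word σ)
  rw [HasPSymbol, pSymbol_eq]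
  constructor
  · rintro ⟨hl, hr⟩
    rw [← hl, ← hr]
    exact ⟨l2, r2⟩
  · rintro ⟨hl, hr⟩
    exact ⟨eq_of_isAncestor_le (Before.asymm (w := word σ)) (l1.trans J.numNodes_left.symm) l2 hl,
      eq_of_isAncestor_le (r := fun x y => Before (word σ) y x)
        (fun x y => Before.asymm (w := word σ) y x) (r1.trans J.numNodes_right.symm) r2 hr⟩

theorem HasPSymbol.unique {n : ℕ} {σ : Equiv.Perm (Fin n)} {J J' : TBT n} (h : HasPSymbol σ J)
    (h' : HasPSymbol σ J') : J = J' :=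
  TBT.ext (h.1.symm.trans h'.1) (h.2.symm.trans h'.2)

/-- The `ℙ`-symbol of a permutation is a pair of twin binary trees. -/
theorem exists_hasPSymbol {n : ℕ} (σ : Equiv.Perm (Fin n)) : ∃ J : TBT n, HasPSymbol σ J := by
  obtain ⟨l1, l2⟩ := leafTree_spec (isArrangement_word σ)
  obtain ⟨r1, r2⟩ := rootTree_spec (isArrangement_word σ)
  refine ⟨⟨_, _, l1, r1, (forall₂_canopy_iff 1 l1 r1).2 fun i hi => ?_⟩, by
    rw [HasPSymbol, pSymbol_eq]; exact ⟨rfl, rfl⟩⟩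
  constructor
  · intro h
    refine isAncestor_of_forall_between (r := fun x y => Before (word σ) y x)
      (fun x y => Before.asymm (w := word σ) y x) r2 (by omega) (by omega) (by omega) (by omega)
      (by omega) fun z hz => ?_
    obtain rfl : z = 1 + i := by omega
    exact l2 _ _ h
  · intro h
    refine isAncestor_of_forall_between (Before.asymm (w := word σ)) l2 (by omega) (by omega)
      (by omega) (by omega) (by omega) fun z hz => ?_
    obtain rfl : z = 1 + i + 1 := by omega
    exact r2 _ _ h

/-! ### Every pair of twin binary trees is a `ℙ`-symbol -/

/-- The precedence relation of `J`: it is forced, directly by one of the two trees, that `x` is to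
the left of `y` in the words of the permutations with `ℙ`-symbol `J`. -/
def TBT.Precedes {n : ℕ} (J : TBT n) (x y : ℕ) : Prop :=
  IsAncestor 1 J.left x y ∨ IsAncestor 1 J.right y x

theorem hasPSymbol_iff_precedes {n : ℕ} {σ : Equiv.Perm (Fin n)} {J : TBT n} :
    HasPSymbol σ J ↔ ∀ x y, J.Precedes x y → Before (word σ) x y := by
  rw [hasPSymbol_iff]
  exact ⟨fun h x y hxy => hxy.elim (h.1 x y) (h.2 y x),
    fun h => ⟨fun x y hxy => h x y (.inl hxy), fun x y hxy => h y x (.inr hxy)⟩⟩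

theorem TBT.Precedes.mem_range {n : ℕ} {J : TBT n} {x y : ℕ} (h : J.Precedes x y) :
    1 ≤ x ∧ x ≤ n ∧ 1 ≤ y ∧ y ≤ n ∧ x ≠ y := by
  have hl := J.numNodes_left
  have hr := J.numNodes_right
  rcases h with h | h <;> have := h.mem_range <;> omega

/-- The two trees of a pair of twin binary trees never force opposite orders of two letters. For
consecutive letters this is the condition on the canopies, and descendants form intervals. -/
theorem TBT.not_isAncestor_both {n : ℕ} (J : TBT n) {x y : ℕ} (hl : IsAncestor 1 J.left x y)
    (hr : IsAncestor 1 J.right x y) : False := by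
  have ht := (forall₂_canopy_iff 1 J.numNodes_left J.numNodes_right).1 J.twin
  have hm := hl.mem_range
  rw [J.numNodes_left] at hm
  rcases lt_or_gt_of_ne hm.2.2.2.2 with h | h
  · have hl' := hl.of_between (z := x + 1) (by omega)
    have hr' := hr.of_between (z := x + 1) (by omega)
    have h1 := ht (x - 1) (by omega)
    rw [show 1 + (x - 1) = x by omega] at h1
    exact hr'.asymm (h1.1 hl')
  · have hl' := hl.of_between (z := x - 1) (by omega)
    have hr' := hr.of_between (z := x - 1) (by omega)
    have h1 := ht (x - 1 - 1) (by omega)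
    rw [show 1 + (x - 1 - 1) = x - 1 by omega, show x - 1 + 1 = x by omega] at h1
    exact hl'.asymm (h1.2 hr')

/-- Two successive precedences, one increasing and the other decreasing, can be shortened. -/
theorem TBT.Precedes.shorten {n : ℕ} {J : TBT n} {u v w : ℕ} (h : J.Precedes u v)
    (h' : J.Precedes v w) (hv : (u < v ∧ w < v) ∨ (v < u ∧ v < w)) : J.Precedes u w := by
  rcases h with h | h <;> rcases h' with h' | h'
  · exact .inl (h.trans h')
  · rcases eq_or_ne u w with rfl | hne
    · exact (J.not_isAncestor_both h h').elim
    · by_cases hb : (u < w ∧ w ≤ v) ∨ (v ≤ w ∧ w < u)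
      · exact .inl (h.of_between hb)
      · exact .inr (h'.of_between (by omega))
  · by_cases hb : (v < u ∧ u ≤ w) ∨ (w ≤ u ∧ u < v)
    · exact (J.not_isAncestor_both (h'.of_between hb) h).elim
    · exact (J.not_isAncestor_both h' (h.of_between (by omega))).elim
  · exact .inr (h'.trans h)

/-- Every chain of precedences can be replaced by a monotone one. -/
theorem TBT.transGen_precedes {n : ℕ} {J : TBT n} {x y : ℕ}
    (h : Relation.TransGen J.Precedes x y) :
    Relation.TransGen (fun a b => a < b ∧ J.Precedes a b) x y ∨
      Relation.TransGen (fun a b => b < a ∧ J.Precedes a b) x y := by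
  have key₁ : ∀ y, Relation.TransGen (fun a b => a < b ∧ J.Precedes a b) x y → ∀ z, z < y →
      J.Precedes y z → Relation.TransGen (fun a b => a < b ∧ J.Precedes a b) x z ∨
      Relation.TransGen (fun a b => b < a ∧ J.Precedes a b) x z := by
    intro y h
    induction h with
    | single h =>
      intro z hz hyz
      have := h.2.shorten hyz (by omega)
      rcases lt_or_gt_of_ne this.mem_range.2.2.2.2 with hlt | hlt
      · exact .inl (.single ⟨hlt, this⟩)
      · exact .inr (.single ⟨hlt, this⟩)
    | tail h1 h2 ih =>
      intro z hz hyz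
      have := h2.2.shorten hyz (by omega)
      rcases lt_or_gt_of_ne this.mem_range.2.2.2.2 with hlt | hlt
      · exact .inl (.tail h1 ⟨hlt, this⟩)
      · exact ih z hlt this
  have key₂ : ∀ y, Relation.TransGen (fun a b => b < a ∧ J.Precedes a b) x y → ∀ z, y < z →
      J.Precedes y z → Relation.TransGen (fun a b => a < b ∧ J.Precedes a b) x z ∨
      Relation.TransGen (fun a b => b < a ∧ J.Precedes a b) x z := by
    intro y h
    induction h with
    | single h =>
      intro z hz hyz
      have := h.2.shorten hyz (by omega)
      rcases lt_or_gt_of_ne this.mem_range.2.2.2.2 with hlt | hlt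
      · exact .inl (.single ⟨hlt, this⟩)
      · exact .inr (.single ⟨hlt, this⟩)
    | tail h1 h2 ih =>
      intro z hz hyz
      have := h2.2.shorten hyz (by omega)
      rcases lt_or_gt_of_ne this.mem_range.2.2.2.2 with hlt | hlt
      · exact ih z hlt this
      · exact .inr (.tail h1 ⟨hlt, this⟩)
  induction h with
  | single h =>
    rcases lt_or_gt_of_ne h.mem_range.2.2.2.2 with hlt | hlt
    · exact .inl (.single ⟨hlt, h⟩)
    · exact .inr (.single ⟨hlt, h⟩)
  | tail _ h ih =>
    rcases ih with ih | ih <;> rcases lt_or_gt_of_ne h.mem_range.2.2.2.2 with hlt | hlt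
    · exact .inl (ih.tail ⟨hlt, h⟩)
    · exact key₁ _ ih _ hlt h
    · exact key₂ _ ih _ hlt h
    · exact .inr (ih.tail ⟨hlt, h⟩)

theorem TBT.not_transGen_precedes_self {n : ℕ} (J : TBT n) (x : ℕ) :
    ¬ Relation.TransGen J.Precedes x x := by
  intro h
  rcases transGen_precedes h with h | h
  · have : ∀ y, Relation.TransGen (fun a b => a < b ∧ J.Precedes a b) x y → x < y := by
      intro y h
      induction h with
      | single h => exact h.1
      | tail _ h ih => exact ih.trans h.1
    exact lt_irrefl x (this x h)
  · have : ∀ y, Relation.TransGen (fun a b => b < a ∧ J.Precedes a b) x y → y < x := by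
      intro y h
      induction h with
      | single h => exact h.1
      | tail _ h ih => exact h.1.trans ih
    exact lt_irrefl x (this x h)

open Classical in
/-- Every pair of twin binary trees is the `ℙ`-symbol of a permutation: the precedence relation is
acyclic, hence contained in a linear order. -/
theorem TBT.exists_perm {n : ℕ} (J : TBT n) : ∃ σ : Equiv.Perm (Fin n), HasPSymbol σ J := by
  have hpo : IsPartialOrder ℕ (Relation.ReflTransGen J.Precedes) :=
    { refl := fun _ => .refl
      trans := fun _ _ _ h h' => h.trans h'
      antisymm := fun x y h h' => by
        rcases Relation.reflTransGen_iff_eq_or_transGen.1 h with e | h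
        · exact e.symm
        · exact (J.not_transGen_precedes_self x (h.trans_left h')).elim }
  obtain ⟨s, hs, hle⟩ := extend_partialOrder (Relation.ReflTransGen J.Precedes)
  have hp := List.perm_insertionSort s (List.range' 1 n)
  have hw : IsArrangement 1 n ((List.range' 1 n).insertionSort s) :=
    ⟨hp.nodup_iff.2 List.nodup_range', fun x => by rw [hp.mem_iff, List.mem_range'_1]⟩
  have hsort := List.pairwise_insertionSort s (List.range' 1 n)
  obtain ⟨σ, hσ⟩ := exists_word_eq hw
  refine ⟨σ, hasPSymbol_iff_precedes.2 fun x y hxy => ?_⟩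
  rw [hσ]
  generalize (List.range' 1 n).insertionSort s = w at *
  have hm := hxy.mem_range
  have hx : x ∈ w := (hw.2 x).2 (by omega)
  have hy : y ∈ w := (hw.2 y).2 (by omega)
  refine (before_or_before hx hm.2.2.2.2).resolve_right fun hb => hm.2.2.2.2 ?_
  have h1 := List.pairwise_iff_getElem.1 hsort _ _ (List.idxOf_lt_length_iff.2 hy)
    (List.idxOf_lt_length_iff.2 hx) hb
  rw [List.getElem_idxOf, List.getElem_idxOf] at h1
  exact hs.antisymm _ _ (hle _ _ (.single hxy)) h1

/-! ### The permutations above a pair of twin binary trees -/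

/-- The `ℙ`-symbol of `σ` is above `J`. -/
def TBT.IsBelow {n : ℕ} (J : TBT n) (σ : Equiv.Perm (Fin n)) : Prop :=
  ∃ J', TBT.LE J J' ∧ HasPSymbol σ J'

/-- Every inversion that is directly forced by `J` is an inversion of `σ`. -/
def TBT.InvBelow {n : ℕ} (J : TBT n) (σ : Equiv.Perm (Fin n)) : Prop :=
  ∀ a c, a < c → J.Precedes c a → Before (word σ) c a

theorem TBT.IsBelow.invBelow {n : ℕ} {J : TBT n} {σ : Equiv.Perm (Fin n)} (h : J.IsBelow σ) :
    J.InvBelow σ := by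
  obtain ⟨J', ⟨σ₀, σ₁, h₀, h₁, hle⟩, hσ⟩ := h
  have hinv := hle.invLE
  rw [hasPSymbol_iff] at h₀ h₁ hσ
  have hl := J'.numNodes_left
  have hr := J'.numNodes_right
  -- `c` precedes the whole interval `[a, c)`, or the whole interval `(a, c]` precedes `a`; this
  -- passes to `σ₁` because it consists of inversions, hence to the common tree of `σ₁` and `σ`
  intro a c hac hca
  have hm := hca.mem_range
  rcases hca with hca | hca
  · refine hσ.1 _ _ (isAncestor_of_forall_between (Before.asymm (w := word σ₁)) h₁.1 (by omega)
      (by omega) (by omega) (by omega) (by omega) fun z hz => ?_)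
    exact hinv _ _ (by omega) (h₀.1 _ _ (hca.of_between hz))
  · refine hσ.2 _ _ (isAncestor_of_forall_between (r := fun x y => Before (word σ₁) y x)
      (fun x y => Before.asymm (w := word σ₁) y x) h₁.2 (by omega)
      (by omega) (by omega) (by omega) (by omega) fun z hz => ?_)
    exact hinv _ _ (by omega) (h₀.2 _ _ (hca.of_between hz))

/-- If every descent of `σ` is directly forced by its `ℙ`-symbol `J`, then all inversions of `σ`
follow from the inversions directly forced by `J`. -/
theorem invLE_of_descents_forced {n : ℕ} {J : TBT n} {σ τ : Equiv.Perm (Fin n)}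
    (hσ : HasPSymbol σ J) (hτ : J.InvBelow τ)
    (hd : ∀ k, k + 1 < n → letter (word σ) (k + 1) < letter (word σ) k →
      J.Precedes (letter (word σ) k) (letter (word σ) (k + 1))) : InvLE σ τ := by
  have hw := isArrangement_word σ
  have hidx : ∀ i, i < n → (word σ).idxOf (letter (word σ) i) = i :=
    fun i hi => (idxOf_letter hw hi).2.2
  have hinj : ∀ i j, i < n → j < n → letter (word σ) i = letter (word σ) j → i = j := by
    intro i j hi hj h
    rw [← hidx i hi, h, hidx j hj]
  rw [hasPSymbol_iff] at hσ
  have main : ∀ N i j, j - i = N → i < j → j < n → letter (word σ) j < letter (word σ) i →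
      Before (word τ) (letter (word σ) i) (letter (word σ) j) := by
    intro N
    induction N using Nat.strong_induction_on with
    | _ N ih =>
    intro i j hN hij hj hlt
    by_cases hmid : ∃ k, i < k ∧ k < j ∧ letter (word σ) j < letter (word σ) k ∧
        letter (word σ) k < letter (word σ) i
    · obtain ⟨k, h1, h2, h3, h4⟩ := hmid
      exact (ih (k - i) (by omega) i k rfl h1 (by omega) h4).trans
        (ih (j - k) (by omega) k j rfl h2 hj h3)
    · push Not at hmid
      -- `k` is the last position before `j` with a letter not less than the letter at `i`
      have hex : ∃ k, i ≤ k ∧ k < j ∧ letter (word σ) i ≤ letter (word σ) k ∧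
          letter (word σ) (k + 1) < letter (word σ) i := by
        by_contra! hno
        have : ∀ k, i ≤ k → k ≤ j → letter (word σ) i ≤ letter (word σ) k := by
          intro k hk
          induction k, hk using Nat.le_induction with
          | base => exact fun _ => le_rfl
          | succ k hk ih' => exact fun hkj => hno k hk (by omega) (ih' (by omega))
        exact absurd (this j hij.le le_rfl) (by omega)
      obtain ⟨k, h1, h2, h3, h4⟩ := hex
      have h5 : letter (word σ) (k + 1) ≤ letter (word σ) j := by
        rcases Nat.lt_or_ge (k + 1) j with h | h
        · have := hmid (k + 1) (by omega) h
          omega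
        · rw [show k + 1 = j by omega]
      refine hτ _ _ hlt ?_
      rcases hd k (by omega) (by omega) with h | h
      · rcases h1.eq_or_lt with rfl | hik
        · exact .inl (h.of_between (by omega))
        · have := hσ.1 _ _ (h.of_between (z := letter (word σ) i) (by
            have := hinj i k (by omega) (by omega)
            omega))
          rw [Before, hidx _ (by omega), hidx _ (by omega)] at this
          omega
      · rcases Nat.lt_or_ge (k + 1) j with hkj | hkj
        · have := hσ.2 _ _ (h.of_between (z := letter (word σ) j) (by
            have := hinj (k + 1) j (by omega) (by omega)
            omega))
          rw [Before, hidx _ (by omega), hidx _ (by omega)] at this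
          omega
        · obtain rfl : k + 1 = j := by omega
          exact .inr (h.of_between (by omega))
  intro a c hac hca
  have hτw := isArrangement_word τ
  have hc : c ∈ word σ := by
    rw [← List.idxOf_lt_length_iff]
    exact lt_of_lt_of_le hca List.idxOf_le_length
  by_cases ha : a ∈ word σ
  swap
  · have ha' : a ∉ word τ := by rwa [hτw.2, ← hw.2]
    rw [Before, List.idxOf_of_notMem ha', List.idxOf_lt_length_iff, hτw.2, ← hw.2]
    exact hc
  rw [hw.2] at ha hc
  have h1 := letter_idxOf hw ha.1 (by omega)
  have h2 := letter_idxOf hw hc.1 (by omega)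
  have := main _ _ _ rfl hca h1.1 (by rw [h1.2, h2.2]; exact hac)
  rwa [h1.2, h2.2] at this

/-- If all inversions directly forced by `J` are inversions of `τ`, then some permutation with
`ℙ`-symbol `J` is below `τ`: start from any permutation with `ℙ`-symbol `J` and remove descents as
long as the `ℙ`-symbol does not change. -/
theorem TBT.InvBelow.exists_invLE {n : ℕ} {J : TBT n} {τ : Equiv.Perm (Fin n)}
    (hτ : J.InvBelow τ) : ∃ σ : Equiv.Perm (Fin n), HasPSymbol σ J ∧ InvLE σ τ := by
  obtain ⟨σ, hσ⟩ := J.exists_perm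
  induction hN : (invSet σ).card using Nat.strong_induction_on generalizing σ with
  | _ N ih =>
  have hw := isArrangement_word σ
  by_cases hd : ∀ k, k + 1 < n → letter (word σ) (k + 1) < letter (word σ) k →
      J.Precedes (letter (word σ) k) (letter (word σ) (k + 1))
  · exact ⟨σ, hσ, invLE_of_descents_forced hσ hτ hd⟩
  · push Not at hd
    obtain ⟨k, hk, hlt, hp⟩ := hd
    obtain ⟨σ', -, h2, h3, h4⟩ := exists_adjacent_swap σ hk
    rw [hasPSymbol_iff_precedes] at hσ
    refine ih _ ?_ σ' (hasPSymbol_iff_precedes.2 fun x y hxy => ?_) rfl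
    · rw [← hN]
      have hle : InvLE σ' σ := fun a c hac hca => h3 _ _ (by omega) hca
      have hb : Before (word σ) (letter (word σ) k) (letter (word σ) (k + 1)) := by
        rw [Before, (idxOf_letter hw (i := k) (by omega)).2.2, (idxOf_letter hw hk).2.2]; omega
      refine Finset.card_lt_card ((Finset.ssubset_iff_of_subset hle.invSet_subset).2
        ⟨(letter (word σ) (k + 1), letter (word σ) k), ?_, ?_⟩)
      · exact (mem_invSet_letter hk (by omega)).2 ⟨hlt, hb⟩
      · rw [mem_invSet_letter hk (by omega)]
        exact fun h => Before.asymm _ _ h4 h.2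
    · refine h2 x y ?_ (hσ x y hxy)
      rintro ⟨rfl, rfl⟩
      exact hp hxy

theorem TBT.InvBelow.exists_permLE {n : ℕ} {J : TBT n} {τ : Equiv.Perm (Fin n)}
    (hτ : J.InvBelow τ) : ∃ σ : Equiv.Perm (Fin n), HasPSymbol σ J ∧ PermLE σ τ :=
  let ⟨σ, hσ, h⟩ := hτ.exists_invLE
  ⟨σ, hσ, h.permLE⟩

/-- The permutations above `J` are those that have all inversions directly forced by `J`. -/
theorem TBT.isBelow_iff {n : ℕ} {J : TBT n} {σ : Equiv.Perm (Fin n)} :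
    J.IsBelow σ ↔ J.InvBelow σ := by
  refine ⟨TBT.IsBelow.invBelow, fun h => ?_⟩
  obtain ⟨σ₀, h₀, hle⟩ := h.exists_permLE
  obtain ⟨J', hJ'⟩ := exists_hasPSymbol σ
  exact ⟨J', ⟨σ₀, σ, h₀, hJ', hle⟩, hJ'⟩

/-! ### The order on pairs of twin binary trees -/

theorem TBT.LE.refl {n : ℕ} (J : TBT n) : TBT.LE J J :=
  let ⟨σ, hσ⟩ := J.exists_perm
  ⟨σ, σ, hσ, hσ, .refl⟩

/-- The least number of inversions of a permutation with `ℙ`-symbol `J`. -/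
noncomputable def TBT.minInv {n : ℕ} (J : TBT n) : ℕ :=
  sInf {N | ∃ σ : Equiv.Perm (Fin n), HasPSymbol σ J ∧ (invSet σ).card = N}

theorem eq_of_invSet_eq {n : ℕ} {σ τ : Equiv.Perm (Fin n)} (h : invSet σ = invSet τ) : σ = τ := by
  have hσ := isArrangement_word σ
  have hτ := isArrangement_word τ
  apply eq_of_before
  intro x hx y hy hxy
  have hyτ : y ∈ word τ := by rwa [hτ.2, ← hσ.2]
  have hne : y ≠ x := by rintro rfl; exact Before.asymm _ _ hxy hxy
  have hx' := (hσ.2 x).1 hx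
  have hy' := (hσ.2 y).1 hy
  have hmem : ∀ (ρ : Equiv.Perm (Fin n)) (a c : ℕ), 1 ≤ a ∧ a < 1 + n → 1 ≤ c ∧ c < 1 + n →
      ((a, c) ∈ invSet ρ ↔ a < c ∧ Before (word ρ) c a) := by
    intro ρ a c ha hc
    simp only [invSet, Finset.mem_filter, Finset.mem_product, Finset.mem_Icc, and_iff_right_iff_imp]
    omega
  rcases lt_or_gt_of_ne hne with hlt | hlt
  · have := (hmem σ y x hy' hx').2 ⟨hlt, hxy⟩
    rw [h, hmem τ y x hy' hx'] at this
    exact this.2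
  · refine (before_or_before hyτ hne).resolve_left fun hb => ?_
    have := (hmem τ x y hx' hy').2 ⟨hlt, hb⟩
    rw [← h, hmem σ x y hx' hy'] at this
    exact Before.asymm _ _ hxy this.2

theorem TBT.LE.minInv_lt {n : ℕ} {J J' : TBT n} (h : TBT.LE J J') (hne : J ≠ J') :
    J.minInv < J'.minInv := by
  obtain ⟨τ, hτ, hcard⟩ : J'.minInv ∈
      {N | ∃ σ : Equiv.Perm (Fin n), HasPSymbol σ J' ∧ (invSet σ).card = N} :=
    Nat.sInf_mem (let ⟨σ, hσ⟩ := J'.exists_perm; ⟨_, σ, hσ, rfl⟩)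
  obtain ⟨σ, hσ, hle⟩ := (TBT.IsBelow.invBelow ⟨J', h, hτ⟩).exists_invLE
  have h1 : J.minInv ≤ (invSet σ).card := Nat.sInf_le ⟨σ, hσ, rfl⟩
  have h2 : (invSet σ).card < (invSet τ).card := by
    refine Finset.card_lt_card (hle.invSet_subset.ssubset_of_ne fun e => hne ?_)
    rw [eq_of_invSet_eq e] at hσ
    exact hσ.unique hτ
  omega

/-! ### Reversal of words -/

/-- The pair of twin binary trees with the two trees exchanged. -/
def TBT.swap {n : ℕ} (J : TBT n) : TBT n where
  left := J.right
  right := J.left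
  numNodes_left := J.numNodes_right
  numNodes_right := J.numNodes_left
  twin := J.twin.flip.imp fun _ _ h => Ne.symm h

/-- The permutation with the reversed word. -/
def reversal {n : ℕ} (σ : Equiv.Perm (Fin n)) : Equiv.Perm (Fin n) := Fin.revPerm.trans σ

theorem word_reversal {n : ℕ} (σ : Equiv.Perm (Fin n)) :
    word (reversal σ) = (word σ).reverse := by
  refine List.ext_getElem (by simp [word]) fun i h1 h2 => ?_
  simp only [word, reversal, List.getElem_ofFn, List.getElem_reverse, List.length_ofFn,
    Equiv.trans_apply, Fin.revPerm_apply]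
  congr 3
  ext
  simp only [Fin.val_rev]
  omega

theorem reversal_reversal {n : ℕ} (σ : Equiv.Perm (Fin n)) : reversal (reversal σ) = σ := by
  ext i; simp [reversal]

/-- Reversing a permutation exchanges the two trees of its `ℙ`-symbol. -/
theorem HasPSymbol.reversal {n : ℕ} {σ : Equiv.Perm (Fin n)} {J : TBT n} (h : HasPSymbol σ J) :
    HasPSymbol (reversal σ) J.swap := by
  have hw := isArrangement_word σ
  rw [hasPSymbol_iff_precedes] at h ⊢
  intro x y hxy
  have hm := hxy.mem_range
  rw [word_reversal, before_reverse_iff hw.1 ((hw.2 x).2 (by omega)) ((hw.2 y).2 (by omega))]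
  exact h y x hxy.symm

theorem hasPSymbol_reversal_iff {n : ℕ} {σ : Equiv.Perm (Fin n)} {J : TBT n} :
    HasPSymbol (reversal σ) J.swap ↔ HasPSymbol σ J :=
  ⟨fun h => reversal_reversal σ ▸ h.reversal, HasPSymbol.reversal⟩

theorem PermLE.reversal {n : ℕ} {σ τ : Equiv.Perm (Fin n)} (h : PermLE σ τ) :
    PermLE (reversal τ) (reversal σ) := by
  induction h with
  | refl => exact .refl
  | tail _ hc ih =>
    obtain ⟨u, v, a, b, hab, h1, h2⟩ := hc
    refine ih.head ⟨v.reverse, u.reverse, a, b, hab, by simp [word_reversal, h2], by simp [word_reversal, h1]⟩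

theorem TBT.LE.swap {n : ℕ} {J J' : TBT n} (h : TBT.LE J J') : TBT.LE J'.swap J.swap :=
  let ⟨_, _, h₀, h₁, hle⟩ := h
  ⟨_, _, h₁.reversal, h₀.reversal, hle.reversal⟩

/-! ### Shifted shuffles -/

/-- For words without a common letter, the terms of the shuffle of `u` and `v` are the words whose
restrictions to the letters of `u` and of `v` are `u` and `v`. -/
theorem mem_shuffle_iff (p : ℕ → Bool) {u v : List ℕ} (hu : ∀ a ∈ u, p a = true)
    (hv : ∀ a ∈ v, p a = false) (w : List ℕ) :
    w ∈ shuffle u v ↔ w.filter p = u ∧ w.filter (fun x => !p x) = v := by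
  induction w generalizing u v with
  | nil =>
    rcases u with _ | ⟨a, u⟩ <;> rcases v with _ | ⟨b, v⟩ <;> simp [shuffle]
  | cons c w ih =>
    rcases u with _ | ⟨a, u⟩
    · rw [shuffle, List.mem_singleton]
      constructor
      · rintro rfl
        refine ⟨List.filter_eq_nil_iff.2 fun a ha => by simp [hv a ha],
          List.filter_eq_self.2 fun a ha => by simp [hv a ha]⟩
      · rintro ⟨h1, h2⟩
        rw [List.filter_eq_nil_iff] at h1
        rw [← h2, eq_comm, List.filter_eq_self]
        intro a ha
        simpa using h1 a ha
    rcases v with _ | ⟨b, v⟩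
    · rw [shuffle, List.mem_singleton]
      constructor
      · rintro h
        rw [h]
        exact ⟨List.filter_eq_self.2 hu,
          List.filter_eq_nil_iff.2 fun a ha => by simp [hu a ha]⟩
      · rintro ⟨h1, h2⟩
        rw [List.filter_eq_nil_iff] at h2
        rw [← h1, eq_comm, List.filter_eq_self]
        intro a ha
        simpa using h2 a ha
    · have hpa := hu a (by simp)
      have hpb := hv b (by simp)
      have ih1 := ih (u := u) (v := b :: v) (fun x hx => hu x (by simp [hx])) hv
      have ih2 := ih (u := a :: u) (v := v) hu (fun x hx => hv x (by simp [hx]))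
      rw [shuffle, List.mem_append, List.mem_map, List.mem_map]
      cases hc : p c
      · rw [List.filter_cons_of_neg (by simp [hc]), List.filter_cons_of_pos (by simp [hc]),
          List.cons.injEq]
        constructor
        · rintro (⟨w', h, h'⟩ | ⟨w', h, h'⟩)
          · simp only [List.cons.injEq] at h'
            rw [h'.1, hc] at hpa
            simp at hpa
          · simp only [List.cons.injEq] at h'
            obtain ⟨rfl, rfl⟩ := h'
            have := ih2.1 h
            exact ⟨this.1, rfl, this.2⟩
        · rintro ⟨h1, rfl, h2⟩
          exact .inr ⟨w, ih2.2 ⟨h1, h2⟩, rfl⟩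
      · rw [List.filter_cons_of_pos (by simp [hc]), List.filter_cons_of_neg (by simp [hc]),
          List.cons.injEq]
        constructor
        · rintro (⟨w', h, h'⟩ | ⟨w', h, h'⟩)
          · simp only [List.cons.injEq] at h'
            obtain ⟨rfl, rfl⟩ := h'
            have := ih1.1 h
            exact ⟨⟨rfl, this.1⟩, this.2⟩
          · simp only [List.cons.injEq] at h'
            rw [h'.1, hc] at hpb
            simp at hpb
        · rintro ⟨⟨rfl, h1⟩, h2⟩
          exact .inl ⟨w, ih1.2 ⟨h1, h2⟩, rfl⟩

/-- The restrictions of a permutation of size `m + n` to its letters `≤ m` and to its letters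
`> m`, the latter decremented by `m`, are permutations. -/
theorem exists_split {m n : ℕ} (π : Equiv.Perm (Fin (m + n))) :
    ∃ q : Equiv.Perm (Fin m) × Equiv.Perm (Fin n),
      (word π).filter (fun x => decide (x ≤ m)) = word q.1 ∧
        (word π).filter (fun x => !decide (x ≤ m)) = (word q.2).map fun a => a + m := by
  have hw := isArrangement_word π
  obtain ⟨σ, hσ⟩ := exists_word_eq (n := m) (w := (word π).filter fun x => decide (x ≤ m))
    ⟨hw.1.filter _, fun x => by simp only [List.mem_filter, hw.2, decide_eq_true_eq]; omega⟩
  have hm : ∀ x ∈ (word π).filter fun x => !decide (x ≤ m), m < x := by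
    intro x hx
    simpa using (List.mem_filter.1 hx).2
  have hmap : (((word π).filter fun x => !decide (x ≤ m)).map fun a => a - m).map
      (fun a => a + m) = (word π).filter fun x => !decide (x ≤ m) := by
    rw [List.map_map]
    conv_rhs => rw [← List.map_id ((word π).filter fun x => !decide (x ≤ m))]
    refine List.map_congr_left fun x hx => ?_
    have := hm x hx
    simp only [Function.comp_apply, id_eq]
    omega
  obtain ⟨ν, hν⟩ := exists_word_eq (n := n)
    (w := ((word π).filter fun x => !decide (x ≤ m)).map fun a => a - m) (by
      refine ⟨List.Nodup.of_map (fun a => a + m) (by rw [hmap]; exact hw.1.filter _), fun x => ?_⟩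
      simp only [List.mem_map, List.mem_filter, hw.2, Bool.not_eq_true', decide_eq_false_iff_not]
      constructor
      · rintro ⟨a, h, rfl⟩; omega
      · intro h; exact ⟨x + m, by omega, by omega⟩)
  exact ⟨(σ, ν), hσ.symm, by rw [hν, hmap]⟩

/-- The unique pair of permutations whose shifted shuffle contains `π`. -/
noncomputable def split {m n : ℕ} (π : Equiv.Perm (Fin (m + n))) :
    Equiv.Perm (Fin m) × Equiv.Perm (Fin n) :=
  (exists_split π).choose

theorem filter_word_eq_split_fst {m n : ℕ} (π : Equiv.Perm (Fin (m + n))) :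
    (word π).filter (fun x => decide (x ≤ m)) = word (split π).1 :=
  (exists_split π).choose_spec.1

theorem filter_word_eq_split_snd {m n : ℕ} (π : Equiv.Perm (Fin (m + n))) :
    (word π).filter (fun x => !decide (x ≤ m)) = (word (split π).2).map fun a => a + m :=
  (exists_split π).choose_spec.2

theorem eq_split_iff {m n : ℕ} {π : Equiv.Perm (Fin (m + n))} {σ : Equiv.Perm (Fin m)}
    {ν : Equiv.Perm (Fin n)} :
    split π = (σ, ν) ↔ (word π).filter (fun x => decide (x ≤ m)) = word σ ∧
      (word π).filter (fun x => !decide (x ≤ m)) = (word ν).map fun a => a + m := by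
  rw [filter_word_eq_split_fst, filter_word_eq_split_snd, word_injective.eq_iff,
    (List.map_injective_iff.2 (add_left_injective m)).eq_iff, word_injective.eq_iff,
    Prod.ext_iff]

theorem mem_shiftedShuffle_iff {m n : ℕ} {π : Equiv.Perm (Fin (m + n))} {σ : Equiv.Perm (Fin m)}
    {ν : Equiv.Perm (Fin n)} : word π ∈ shiftedShuffle σ ν ↔ split π = (σ, ν) := by
  rw [eq_split_iff, shiftedShuffle, mem_shuffle_iff fun x => decide (x ≤ m)]
  · intro a ha
    have := ((isArrangement_word σ).2 a).1 ha
    simp; omega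
  · intro a ha
    obtain ⟨b, hb, rfl⟩ := List.mem_map.1 ha
    have := ((isArrangement_word ν).2 b).1 hb
    simp; omega

theorem split_reversal {m n : ℕ} (π : Equiv.Perm (Fin (m + n))) :
    split (reversal π) = (reversal (split π).1, reversal (split π).2) := by
  rw [eq_split_iff, word_reversal, word_reversal, word_reversal, List.filter_reverse,
    List.filter_reverse, filter_word_eq_split_fst, filter_word_eq_split_snd, List.map_reverse]
  exact ⟨rfl, rfl⟩

/-! ### Graftings and the order -/

/-- The inversions directly forced by `J₀ ╱ J₁` are those forced by `J₀` and the shifts of those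
forced by `J₁`. -/
theorem TBT.precedes_over_iff {m n : ℕ} (J₀ : TBT m) (J₁ : TBT n) {a c : ℕ} (hac : a < c) :
    (J₀.over J₁).Precedes c a ↔
      J₀.Precedes c a ∨ ∃ a' c', a = a' + m ∧ c = c' + m ∧ J₁.Precedes c' a' := by
  have hshift : (IsAncestor (1 + m) J₁.left c a ∨ IsAncestor (1 + m) J₁.right a c) ↔
      ∃ a' c', a = a' + m ∧ c = c' + m ∧ J₁.Precedes c' a' := by
    constructor
    · intro h
      have hm : m ≤ a := by rcases h with h | h <;> have := h.mem_range <;> omega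
      obtain ⟨a', rfl⟩ := Nat.exists_eq_add_of_le' hm
      obtain ⟨c', rfl⟩ := Nat.exists_eq_add_of_le' (hm.trans hac.le)
      rw [isAncestor_add, isAncestor_add] at h
      exact ⟨a', c', rfl, rfl, h⟩
    · rintro ⟨a', c', rfl, rfl, h⟩
      rw [isAncestor_add, isAncestor_add]
      exact h
  rw [← hshift]
  simp only [TBT.Precedes, TBT.over, isAncestor_graftRight _ _ hac, isAncestor_graftLeft _ _ hac,
    J₀.numNodes_left, J₀.numNodes_right]
  tauto

theorem TBT.isBelow_over_iff {m n : ℕ} (J₀ : TBT m) (J₁ : TBT n)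
    (π : Equiv.Perm (Fin (m + n))) :
    (J₀.over J₁).IsBelow π ↔ J₀.IsBelow (split π).1 ∧ J₁.IsBelow (split π).2 := by
  have h₀ : ∀ a c, J₀.Precedes c a →
      (Before (word (split π).1) c a ↔ Before (word π) c a) := by
    intro a c h
    have := h.mem_range
    rw [← filter_word_eq_split_fst]
    exact before_filter_iff _ _ (by simp; omega) (by simp; omega)
  have h₁ : ∀ a c, J₁.Precedes c a →
      (Before (word (split π).2) c a ↔ Before (word π) (c + m) (a + m)) := by
    intro a c h
    have := h.mem_range
    rw [← before_map_add_iff m, ← filter_word_eq_split_snd]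
    exact before_filter_iff _ _ (by simp; omega) (by simp; omega)
  simp only [TBT.isBelow_iff]
  constructor
  · intro h
    refine ⟨fun a c hac hca => ?_, fun a c hac hca => ?_⟩
    · exact (h₀ a c hca).2 (h a c hac ((TBT.precedes_over_iff _ _ hac).2 (.inl hca)))
    · have hac' : a + m < c + m := by omega
      exact (h₁ a c hca).2
        (h _ _ hac' ((TBT.precedes_over_iff _ _ hac').2 (.inr ⟨a, c, rfl, rfl, hca⟩)))
  · rintro ⟨h, h'⟩ a c hac hca
    rcases (TBT.precedes_over_iff _ _ hac).1 hca with hca' | ⟨a, c, rfl, rfl, hca'⟩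
    · exact (h₀ a c hca').1 (h a c hac hca')
    · exact (h₁ a c hca').1 (h' a c (by omega) hca')

/-- The `ℙ`-symbol of `σ` is below `J`. -/
def TBT.IsAbove {n : ℕ} (J : TBT n) (σ : Equiv.Perm (Fin n)) : Prop :=
  ∃ J', TBT.LE J' J ∧ HasPSymbol σ J'

theorem TBT.isAbove_iff_isBelow_swap {n : ℕ} {J : TBT n} {σ : Equiv.Perm (Fin n)} :
    J.IsAbove σ ↔ J.swap.IsBelow (reversal σ) := by
  constructor
  · rintro ⟨J', h, hσ⟩
    exact ⟨J'.swap, h.swap, hσ.reversal⟩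
  · rintro ⟨J', h, hσ⟩
    exact ⟨J'.swap, h.swap, hasPSymbol_reversal_iff.1 hσ⟩

theorem TBT.isAbove_under_iff {m n : ℕ} (J₀ : TBT m) (J₁ : TBT n)
    (π : Equiv.Perm (Fin (m + n))) :
    (J₀.under J₁).IsAbove π ↔ J₀.IsAbove (split π).1 ∧ J₁.IsAbove (split π).2 := by
  have h : (J₀.under J₁).swap = J₀.swap.over J₁.swap := rfl
  simp only [TBT.isAbove_iff_isBelow_swap, h, TBT.isBelow_over_iff, split_reversal]

/-! ### The product of `FQSym` -/

section

variable (K : Type*) [Field K]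

theorem FQSym.add_mul (x y z : FQSym K) : (x + y) * z = x * z + y * z := by
  refine Finsupp.sum_add_index' (fun σ => ?_) fun σ a b => ?_
  · simp only [zero_mul, zero_smul]
    exact Finset.sum_const_zero
  · simp only [_root_.add_mul, add_smul]
    exact Finsupp.sum_add

theorem FQSym.mul_add (x y z : FQSym K) : x * (y + z) = x * y + x * z := by
  refine Eq.trans (Finset.sum_congr rfl fun σ _ => ?_) Finset.sum_add_distrib
  refine Finsupp.sum_add_index' (fun ν => ?_) fun ν a b => ?_
  · simp
  · rw [_root_.mul_add, add_smul]

theorem FQSym.sum_mul {ι : Type*} (s : Finset ι) (f : ι → FQSym K) (y : FQSym K) :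
    (∑ i ∈ s, f i) * y = ∑ i ∈ s, f i * y :=
  map_sum (AddMonoidHom.mk' (fun x : FQSym K => x * y) fun a b => FQSym.add_mul K a b y) f s

theorem FQSym.mul_sum {ι : Type*} (s : Finset ι) (x : FQSym K) (f : ι → FQSym K) :
    x * (∑ i ∈ s, f i) = ∑ i ∈ s, x * f i :=
  map_sum (AddMonoidHom.mk' (fun y : FQSym K => x * y) fun a b => FQSym.mul_add K x a b) f s

theorem F_mul_F {m n : ℕ} (σ : Equiv.Perm (Fin m)) (ν : Equiv.Perm (Fin n)) :
    F K σ * F K ν = mulBasis K σ ν := by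
  refine (Finsupp.sum_single_index (by
    simp only [zero_mul, zero_smul]; exact Finset.sum_const_zero)).trans ?_
  exact (Finsupp.sum_single_index (by simp)).trans (by simp)

open Classical in
/-- The product of two sums of fundamental basis elements has the term `F_π` if and only if the
two restrictions of `π` occur in the factors. -/
theorem sum_F_mul_sum_F {m n : ℕ} (p : Equiv.Perm (Fin m) → Prop) (q : Equiv.Perm (Fin n) → Prop) :
    (∑ σ with p σ, F K σ) * (∑ ν with q ν, F K ν) =
      ∑ π : Equiv.Perm (Fin (m + n)) with p (split π).1 ∧ q (split π).2, F K π := by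
  have h := Finset.sum_fiberwise_eq_sum_filter Finset.univ
    (({σ | p σ} : Finset (Equiv.Perm (Fin m))) ×ˢ ({ν | q ν} : Finset (Equiv.Perm (Fin n))))
    split (F K)
  rw [Finset.sum_product] at h
  rw [FQSym.sum_mul]
  simp_rw [FQSym.mul_sum, F_mul_F, mulBasis, mem_shiftedShuffle_iff]
  convert h using 2
  ext π
  simp

/-! ### The families `E` and `H` -/

open Classical in
theorem sum_P {n : ℕ} (r : TBT n → Prop) :
    ∑ J with r J, P K J =
      ∑ σ : Equiv.Perm (Fin n) with ∃ J, r J ∧ HasPSymbol σ J, F K σ := by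
  choose symbol hsymbol using exists_hasPSymbol (n := n)
  have h : ∀ σ J, HasPSymbol σ J ↔ symbol σ = J :=
    fun σ J => ⟨(hsymbol σ).unique, fun e => e ▸ hsymbol σ⟩
  simp only [P, h]
  have h' := Finset.sum_fiberwise_eq_sum_filter Finset.univ ({J | r J} : Finset (TBT n)) symbol
    (F K)
  convert h' using 2
  ext π
  simp

open Classical in
theorem E_eq {n : ℕ} (J : TBT n) : E K J = ∑ σ with J.IsBelow σ, F K σ := by
  rw [E, sum_P]
  exact Finset.sum_congr (by ext; simp only [Finset.mem_filter]; rfl) fun _ _ => rfl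

open Classical in
theorem H_eq {n : ℕ} (J : TBT n) : H K J = ∑ σ with J.IsAbove σ, F K σ := by
  rw [H, sum_P]
  exact Finset.sum_congr (by ext; simp only [Finset.mem_filter]; rfl) fun _ _ => rfl

theorem E_mul_E {m n : ℕ} (J₀ : TBT m) (J₁ : TBT n) :
    E K J₀ * E K J₁ = E K (J₀.over J₁) := by
  rw [E_eq, E_eq, E_eq, sum_F_mul_sum_F]
  exact Finset.sum_congr (by ext; simp [TBT.isBelow_over_iff]) fun _ _ => rfl

theorem H_mul_H {m n : ℕ} (J₀ : TBT m) (J₁ : TBT n) :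
    H K J₀ * H K J₁ = H K (J₀.under J₁) := by
  rw [H_eq, H_eq, H_eq, sum_F_mul_sum_F]
  exact Finset.sum_congr (by ext; simp [TBT.isAbove_under_iff]) fun _ _ => rfl

/-- The coefficient of `F_σ`. -/
noncomputable def coeff {n : ℕ} (σ : Equiv.Perm (Fin n)) : FQSym K →ₗ[K] K :=
  Finsupp.lapply (R := K) (⟨n, σ⟩ : Σ n : ℕ, Equiv.Perm (Fin n))

open Classical in
theorem coeff_F {m n : ℕ} (σ : Equiv.Perm (Fin n)) (τ : Equiv.Perm (Fin m)) :
    coeff K σ (F K τ) = if (⟨m, τ⟩ : Σ n : ℕ, Equiv.Perm (Fin n)) = ⟨n, σ⟩ then 1 else 0 :=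
  Finsupp.single_apply

open Classical in
theorem coeff_sum_P {n : ℕ} (r : TBT n → Prop) {σ : Equiv.Perm (Fin n)} {J : TBT n}
    (hσ : HasPSymbol σ J) : coeff K σ (∑ J' with r J', P K J') = if r J then 1 else 0 := by
  have h : (∃ J', r J' ∧ HasPSymbol σ J') ↔ r J :=
    ⟨fun ⟨J', h, h'⟩ => hσ.unique h' ▸ h, fun h => ⟨J, h, hσ⟩⟩
  simp [sum_P, coeff_F, h]

open Classical in
theorem coeff_sum_P_of_ne {m n : ℕ} (h : m ≠ n) (r : TBT m → Prop) (σ : Equiv.Perm (Fin n)) :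
    coeff K σ (∑ J' with r J', P K J') = 0 := by
  rw [sum_P, map_sum]
  refine Finset.sum_eq_zero fun τ _ => ?_
  rw [coeff_F, if_neg]
  intro e
  exact h (congrArg Sigma.fst e)

open Classical in
/-- A family that is unitriangular with respect to the `P_J`, for some rank function on the pairs
of twin binary trees, is a basis of `Baxter`. -/
theorem basis_of_triangular (r : ∀ n : ℕ, TBT n → TBT n → Prop) (rank : ∀ n : ℕ, TBT n → ℕ)
    (hrefl : ∀ n J, r n J J) (hlt : ∀ n J J', r n J J' → J ≠ J' → rank n J' < rank n J) :
    LinearIndependent K (fun J : (Σ n : ℕ, TBT n) => ∑ J' with r J.1 J.2 J', P K J') ∧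
      Submodule.span K (Set.range fun J : (Σ n : ℕ, TBT n) => ∑ J' with r J.1 J.2 J', P K J') =
        Baxter K := by
  constructor
  · rw [linearIndependent_iff']
    intro s g hg
    by_contra! hne
    obtain ⟨i₀, hi₀, hgi₀⟩ := hne
    obtain ⟨⟨n, J⟩, hi, hmax⟩ := Finset.exists_max_image (s.filter fun i => g i ≠ 0)
      (fun i => rank i.1 i.2) ⟨i₀, by simp [hi₀, hgi₀]⟩
    rw [Finset.mem_filter] at hi
    obtain ⟨σ, hσ⟩ := J.exists_perm
    apply hi.2
    have h := congrArg (coeff K σ) hg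
    rw [map_sum, map_zero, Finset.sum_eq_single ⟨n, J⟩] at h
    · rw [map_smul, coeff_sum_P K _ hσ, if_pos (hrefl n J)] at h
      simpa using h
    · rintro ⟨m, J'⟩ hs hJ'
      rw [map_smul]
      by_cases hgz : g ⟨m, J'⟩ = 0
      · rw [hgz, zero_smul]
      rcases eq_or_ne m n with rfl | hmn
      · rw [coeff_sum_P K _ hσ, if_neg, smul_zero]
        intro hr
        have h1 := hlt m J' J hr fun e => hJ' (by rw [e])
        have h2 := hmax ⟨m, J'⟩ (by simp [hs, hgz])
        exact absurd h1 (not_lt.2 h2)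
      · rw [coeff_sum_P_of_ne K hmn, smul_zero]
    · exact fun h => (h hi.1).elim
  · apply le_antisymm
    · rw [Submodule.span_le]
      rintro _ ⟨J, rfl⟩
      exact Submodule.sum_mem _ fun J' _ => Submodule.subset_span ⟨⟨J.1, J'⟩, rfl⟩
    · rw [Baxter, Submodule.span_le]
      rintro _ ⟨⟨n, J⟩, rfl⟩
      induction hN : rank n J using Nat.strong_induction_on generalizing J with
      | _ N ih =>
      have hmem : J ∈ ({J' | r n J J'} : Finset (TBT n)) := by simp [hrefl]
      have h := Finset.add_sum_erase _ (fun J' => P K J') hmem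
      dsimp only
      rw [← eq_sub_iff_add_eq] at h
      rw [h]
      refine Submodule.sub_mem _ (Submodule.subset_span ⟨⟨n, J⟩, rfl⟩)
        (Submodule.sum_mem _ fun J' hJ' => ?_)
      simp only [Finset.mem_erase, Finset.mem_filter, Finset.mem_univ, true_and] at hJ'
      exact ih _ (hN ▸ hlt n J J' hJ'.2 hJ'.1.symm) J' rfl

end

end BaxterHopf

/-- The `E_J` are triangular for the rank that counts inversions after exchanging the two trees, the
`H_J` for the rank that counts inversions. -/
theorem mainTheorem8 (K : Type*) [Field K] [CharZero K] :
    -- the families `E` and `H` are bases of `Baxter`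
    (LinearIndependent K (fun J : (Σ n : ℕ, BaxterHopf.TBT n) => BaxterHopf.E K J.2) ∧
      Submodule.span K (Set.range fun J : (Σ n : ℕ, BaxterHopf.TBT n) => BaxterHopf.E K J.2) =
        BaxterHopf.Baxter K) ∧
    (LinearIndependent K (fun J : (Σ n : ℕ, BaxterHopf.TBT n) => BaxterHopf.H K J.2) ∧
      Submodule.span K (Set.range fun J : (Σ n : ℕ, BaxterHopf.TBT n) => BaxterHopf.H K J.2) =
        BaxterHopf.Baxter K) ∧
    -- and they are multiplicative
    ∀ (m n : ℕ) (J₀ : BaxterHopf.TBT m) (J₁ : BaxterHopf.TBT n),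
      BaxterHopf.E K J₀ * BaxterHopf.E K J₁ = BaxterHopf.E K (J₀.over J₁) ∧
      BaxterHopf.H K J₀ * BaxterHopf.H K J₁ = BaxterHopf.H K (J₀.under J₁) := by
  refine ⟨?_, ?_, fun m n J₀ J₁ =>
    ⟨BaxterHopf.E_mul_E K J₀ J₁, BaxterHopf.H_mul_H K J₀ J₁⟩⟩
  · exact BaxterHopf.basis_of_triangular K (fun _ J J' => BaxterHopf.TBT.LE J J')
      (fun _ J => J.swap.minInv) (fun _ J => .refl J)
      fun _ J J' h hne => h.swap.minInv_lt fun e => hne (congrArg BaxterHopf.TBT.swap e).symm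
  · exact BaxterHopf.basis_of_triangular K (fun _ J J' => BaxterHopf.TBT.LE J' J)
      (fun _ J => J.minInv) (fun _ J => .refl J) fun _ J J' h hne => h.minInv_lt hne.symm
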